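/- Let $\Omega$ be the set of all degree sequences of trees, i.e. of all sequences $\mathcal D=(d_1,\dots,d_s)$ of non-negative integers with $d_1\ge d_2\ge\dots\ge d_s$ and $\sum_{i=1}^s d_i=s-2$ (here $d_i+1$ is a degree). For $\mathcal D\in\Omega$ put $s^{\mathcal D}=s$, let $N^{\mathcal D}$ be such that $N^{\mathcal D}+2=\#\{i:d_i=0\}$, let $\sigma^{\mathcal D}=\big(\sum_{i=1}^s d_i(d_i-1)\big)^{1/2}$ and $\lambda^{\mathcal D}=\sigma^{\mathcal D}/s^{\mathcal D}$. Let $T^{\mathcal D}$ be a uniform random element of the finite set of all trees with vertex set $\{V_i\}_{i:d_i>0}\cup\{\star_j\}_{0\le j\le N^{\mathcal D}+1}$ in which $V_i$ has degree $d_i+1$ for every $i$ with $d_i>0$ (the $\star_j$ are then the leaves). For a finite multigraph $G=(V,E)$ (loops and multiple edges allowed, $E$ a multiset of unordered pairs), let $\square(G)$ be the number, counted with multiplicity, of edges $e\in E$ such that $(V,E\setminus\{e\})$ is connected, where only one copy of $e$ is removed. Let $\#_{v,w}(G)$ be the number of edges $\{v,w\}$ of $G$ and $$\circ(G)=\prod_{v\in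 V}2^{\#_{v,v}(G)}\prod_{\{v,w\}}\#_{v,w}(G)!,$$ where the last product is over the unordered pairs $\{v,w\}$ of vertices, $v=w$ included. Gluing two leaves $L_1\ne L_2$ of $G$, whose only neighbours are $F_1$ and $F_2$, means deleting the vertices $L_1,L_2$ and the edges $\{F_1,L_1\},\{F_2,L_2\}$ and adding one edge $\{F_1,F_2\}$. For a tree $T$ as above with $N^{\mathcal D}\ge 2k$ and for $1\le i\le k$, let $\mathcal G_i(T)$ be the multigraph obtained from $T$ by gluing the pairs $(\star_1,\star_2),(\star_3,\star_4),\dots,(\star_{2i-1},\star_{2i})$, and let $$\square_{\square,k}(T)=\frac{\circ(\mathcal G_k(T))}{\prod_{i=1}^k\square(\mathcal G_i(T))}.$$ Proposition. For every integer $k\ge 1$, the random variables $\square_{\square,k}(T^{\mathcal D})/(\lambda^{\mathcal D})^k$, over all $\mathcal D\in\Omega$ with $N^{\mathcal D}\ge 2k$, are uniformly integrable: with $h_m(x)=x\mathbf 1_{x\ge m}$ for $x,m\ge 0$, $$\lim_{m\to\infty}\ \sup_{\mathcal D\in\Omega:\,N^{\mathcal D}\ge 2k}\mathbb E\left[h_m\left(\frac{\square_{\square,k}(T^{\mathcal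 D})}{(\lambda^{\mathcal D})^k}\right)\right]=0 .$$ -/

import Mathlib

open Filter Topology

/-- A finite multigraph: a finite set of vertices and a multiset of unordered pairs of vertices,
so that loops and multiple edges are allowed. -/
structure Multigraph (α : Type*) where
  verts : Finset α
  edges : Multiset (Sym2 α)
  incidence : ∀ e ∈ edges, ∀ v ∈ e, v ∈ verts

namespace Multigraph

variable {α : Type*}

/-- `G` is connected: it has a vertex, and any two vertices are joined by a path. -/
def Connected (G : Multigraph α) : Prop :=
  G.verts.Nonempty ∧ ∀ u ∈ G.verts, ∀ v ∈ G.verts,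
    (SimpleGraph.fromEdgeSet {e : Sym2 α | e ∈ G.edges}).Reachable u v

open Classical in
/-- Removal of one copy of the edge `e`; the vertices are kept. -/
noncomputable def deleteEdge (G : Multigraph α) (e : Sym2 α) : Multigraph α where
  verts := G.verts
  edges := G.edges.erase e
  incidence := fun f hf => G.incidence f (Multiset.mem_of_mem_erase hf)

open Classical in
/-- The multiset of the edges whose removal does not disconnect `G`; an edge of multiplicity `r`
is listed `r` times. -/
noncomputable def cyc (G : Multigraph α) : Multiset (Sym2 α) :=
  G.edges.filter fun e => (G.deleteEdge e).Connected

/-- The number (with multiplicity) of edges whose removal does not disconnect `G`. -/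
noncomputable def square (G : Multigraph α) : ℕ := G.cyc.card

open Classical in
/-- The multiplicity of `e` as an edge of `G`. -/
noncomputable def mult (G : Multigraph α) (e : Sym2 α) : ℕ := G.edges.count e

/-- The product of `2 ^ (number of loops at v)` over the vertices `v`, times the product of
`(number of edges {v, w})!` over the unordered pairs `{v, w}` of vertices, `v = w` included. -/
noncomputable def circ (G : Multigraph α) : ℕ :=
  (∏ v ∈ G.verts, 2 ^ G.mult s(v, v)) * ∏ e ∈ G.verts.sym2, (G.mult e).factorial

open Classical in
/-- The father of a leaf `L`: the only vertex adjacent to `L`. -/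
noncomputable def father (G : Multigraph α) (L : α) : α :=
  if h : ∃ F, s(F, L) ∈ G.edges then h.choose else L

open Classical in
/-- Gluing of the leaves `L₁ ≠ L₂`, with fathers `F₁` and `F₂`: delete the vertices `L₁`, `L₂` and
the edges `{F₁, L₁}`, `{F₂, L₂}`, and add an edge `{F₁, F₂}` (a loop if `F₁ = F₂`). The filter
only makes the operation total: it removes nothing if `L₁`, `L₂` are distinct non-adjacent leaves,
see `edges_glue`. -/
noncomputable def glue (G : Multigraph α) (L₁ L₂ : α) : Multigraph α where
  verts := (G.verts.erase L₁).erase L₂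
  edges := (s(G.father L₁, G.father L₂) ::ₘ
    (G.edges.erase s(G.father L₁, L₁)).erase s(G.father L₂, L₂)).filter
      fun e => ∀ v ∈ e, v ∈ (G.verts.erase L₁).erase L₂
  incidence := fun _ he => (Multiset.mem_filter.mp he).2

theorem father_eq {G : Multigraph α} {L F : α} (hmem : s(F, L) ∈ G.edges)
    (huniq : ∀ F', s(F', L) ∈ G.edges → F' = F) : G.father L = F := by
  classical
  have h : ∃ F, s(F, L) ∈ G.edges := ⟨F, hmem⟩
  have : G.father L = h.choose := by simp only [father, dif_pos h]
  rw [this]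
  exact huniq _ h.choose_spec

open Classical in
/-- If `L₁ ≠ L₂` are leaves whose only edges are `{F₁, L₁}` and `{F₂, L₂}` respectively (each of
multiplicity one), and are not adjacent to each other nor to themselves, then gluing replaces these
two edges by `{F₁, F₂}`. -/
theorem edges_glue {G : Multigraph α} {L₁ L₂ F₁ F₂ : α}
    (h₁ : G.edges.filter (fun e => L₁ ∈ e) = {s(F₁, L₁)})
    (h₂ : G.edges.filter (fun e => L₂ ∈ e) = {s(F₂, L₂)})
    (h11 : F₁ ≠ L₁) (h12 : F₁ ≠ L₂) (h21 : F₂ ≠ L₁) (h22 : F₂ ≠ L₂) :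
    (G.glue L₁ L₂).edges = s(F₁, F₂) ::ₘ (G.edges.erase s(F₁, L₁)).erase s(F₂, L₂) := by
  have key : ∀ {L F : α}, F ≠ L → G.edges.filter (fun e => L ∈ e) = {s(F, L)} →
      s(F, L) ∈ G.edges ∧ G.father L = F ∧ ∀ e ∈ G.edges.erase s(F, L), L ∉ e := by
    intro L F hFL h
    have hm : s(F, L) ∈ G.edges :=
      (Multiset.mem_filter.mp (h ▸ Multiset.mem_singleton_self _ :
        s(F, L) ∈ G.edges.filter (fun e => L ∈ e))).1
    refine ⟨hm, father_eq hm ?_, ?_⟩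
    · intro F' hF'
      have : s(F', L) ∈ G.edges.filter (fun e => L ∈ e) := by simp [hF']
      rw [h, Multiset.mem_singleton] at this
      rcases Sym2.eq_iff.mp this with ⟨a, _⟩ | ⟨a, b⟩
      · exact a
      · exact absurd b.symm hFL
    · intro e he hL
      have h' := h
      rw [← Multiset.cons_erase hm, Multiset.filter_cons_of_pos _ (by simp)] at h'
      have h0 : (G.edges.erase s(F, L)).filter (fun e => L ∈ e) = 0 := by
        simpa using congrArg (fun m => m.erase s(F, L)) h'
      have : e ∈ (G.edges.erase s(F, L)).filter (fun e => L ∈ e) := by simp [he, hL]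
      simp [h0] at this
  obtain ⟨m₁, f₁, n₁⟩ := key h11 h₁
  obtain ⟨m₂, f₂, n₂⟩ := key h22 h₂
  have v₁ := G.incidence _ m₁ F₁ (by simp)
  have v₂ := G.incidence _ m₂ F₂ (by simp)
  simp only [glue, f₁, f₂]
  rw [Multiset.filter_eq_self]
  intro e he v hv
  simp only [Finset.mem_erase]
  rcases Multiset.mem_cons.mp he with rfl | he
  · rcases Sym2.mem_iff.mp hv with rfl | rfl
    · exact ⟨h12, h11, v₁⟩
    · exact ⟨h22, h21, v₂⟩
  · have he₁ := Multiset.mem_of_mem_erase he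
    refine ⟨?_, ?_, G.incidence _ (Multiset.mem_of_mem_erase he₁) v hv⟩
    · rintro rfl
      rw [Multiset.erase_comm] at he
      exact n₂ e (Multiset.mem_of_mem_erase he) hv
    · rintro rfl
      exact n₁ e he₁ hv

/-- Gluing of the `k` pairs `(L 1, L 2), …, (L (2k-1), L (2k))`, the last pair first. -/
noncomputable def glueAll (L : ℕ → α) : ℕ → Multigraph α → Multigraph α
  | 0, G => G
  | k + 1, G => glueAll L k (G.glue (L (2 * k + 1)) (L (2 * k + 2)))

end Multigraph

open Classical in
/-- A finite simple graph, seen as a multigraph. -/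
noncomputable def SimpleGraph.toMultigraph {α : Type*} [Fintype α] (T : SimpleGraph α) :
    Multigraph α where
  verts := Finset.univ
  edges := T.edgeFinset.val
  incidence := fun _ _ _ _ => Finset.mem_univ _

/-- The degree sequences of trees: `d₁ ≥ ⋯ ≥ dₛ ≥ 0` with `d₁ + ⋯ + dₛ = s - 2`. -/
structure DegreeSeq where
  s : ℕ
  d : Fin s → ℕ
  anti : Antitone d
  sum_add_two : ∑ i, d i + 2 = s

namespace DegreeSeq

/-- The number of indices `i` with `dᵢ = 0` is `N + 2`, see `card_zeros`. -/
def N (D : DegreeSeq) : ℕ := (Finset.univ.filter fun i => D.d i = 0).card - 2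

theorem card_zeros (D : DegreeSeq) :
    (Finset.univ.filter fun i => D.d i = 0).card = D.N + 2 := by
  have h1 : (Finset.univ.filter fun i => D.d i = 0).card +
      (Finset.univ.filter fun i => ¬ D.d i = 0).card = D.s := by
    rw [Finset.card_filter_add_card_filter_not]; simp
  have h2 : (Finset.univ.filter fun i => ¬ D.d i = 0).card ≤ ∑ i, D.d i := by
    rw [Finset.card_filter]
    refine Finset.sum_le_sum fun i _ => ?_
    split_ifs <;> omega
  have h3 := D.sum_add_two
  unfold N
  omega

/-- `σ = √(∑ dᵢ (dᵢ - 1))`. -/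
noncomputable def sigma (D : DegreeSeq) : ℝ := √(∑ i, (D.d i : ℝ) * ((D.d i : ℝ) - 1))

/-- `λ = σ / s`. -/
noncomputable def lam (D : DegreeSeq) : ℝ := D.sigma / D.s

/-- The vertices of a tree with degree sequence `D`: the `Vᵢ` with `dᵢ > 0`, and the
`⋆ⱼ` with `0 ≤ j ≤ N + 1`. -/
abbrev Vert (D : DegreeSeq) : Type := {i : Fin D.s // 0 < D.d i} ⊕ Fin (D.N + 2)

/-- The vertex `⋆ⱼ`; this is only meant for `j ≤ N + 1` (larger `j` are reduced mod `N + 2`). -/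
def star (D : DegreeSeq) (j : ℕ) : D.Vert := Sum.inr (Fin.ofNat (D.N + 2) j)

open Classical in
/-- The finite set of the trees on these vertices in which every `Vᵢ` has degree `dᵢ + 1`. -/
noncomputable def trees (D : DegreeSeq) : Finset (SimpleGraph D.Vert) :=
  Finset.univ.filter fun T => T.IsTree ∧ ∀ i, T.degree (Sum.inl i) = D.d i + 1

/-- The expectation of `f` at a uniform random element of `D.trees`. -/
noncomputable def expectation (D : DegreeSeq) (f : SimpleGraph D.Vert → ℝ) : ℝ :=
  (∑ T ∈ D.trees, f T) / D.trees.card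

/-- The tree `T` in which the pairs `(⋆₁, ⋆₂), …, (⋆₂ᵢ₋₁, ⋆₂ᵢ)` are glued. -/
noncomputable def glued (D : DegreeSeq) (i : ℕ) (T : SimpleGraph D.Vert) : Multigraph D.Vert :=
  T.toMultigraph.glueAll D.star i

/-- The cycle-breaking bias of the tree `T`. -/
noncomputable def bias (D : DegreeSeq) (k : ℕ) (T : SimpleGraph D.Vert) : ℝ :=
  ((D.glued k T).circ : ℝ) / ∏ i ∈ Finset.Icc 1 k, ((D.glued i T).square : ℝ)

end DegreeSeq

open Classical in
/-- `h m x` is `x` if `x ≥ m` and `0` otherwise. -/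
noncomputable def truncBelow (m x : ℝ) : ℝ := if m ≤ x then x else 0

/-! It suffices to bound a moment of order above 1 uniformly. The exponent used is 3/2, since `x ≤ x
^ (3/2) / √m` when `x ≥ m` (`truncBelow_le`).

First, the bias is controlled by distances. Gluing adds at most `k` edges to a simple graph, so
`circ` is bounded in terms of `k`. The edge created by gluing two leaves closes a cycle along the
path between them, so `square` is at least their distance minus one
(`IsTree.circ_le_and_dist_le_square`). Hence `bias ^ (3/2)` is at most a constant times the product
of `dist ^ (-3/2)` over the glued pairs (`bias_rpow_le`).

It remains to show that this product has expectation `O((σ / s) ^ (3k/2))`, which is `PairBound`, by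
induction on the number of pairs. For one further pair `B`, `z`, the path from `B` to `z` is
explored by contracting its next vertex `i` into `B`. Contraction shortens the other distances, so
it only increases their weights. Comparing the closed count `(s - 2)! / ∏ d!` before and after, and
counting the trees with a given contraction, shows that such a step costs a factor `d i / (s - 2)`
(`sum_merge_toward_le_of_le`): the exploration is dominated by a size-biased one. The degree `b` of
the explored cluster is then tracked by `chainFactor`, a supersolution of the resulting recursion
(`sum_chainFactor_le`).

Distance `t + 1` thus costs about `(q / s)² t` as long as `t ≤ s / (8q)`, where `q` bounds `σ`.
Summing `t ^ (-3/2) · t` over this range gives `(q / s) ^ (3/2)`, while at larger distances the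
weight itself is of that order. The matching lower bound on the number of trees
(`treeCount_le_card`) turns sums over trees into expectations. -/

namespace SimpleGraph

/-! ### Contracting an edge of a tree -/

section Merge

variable {V : Type*}

open Classical in
/-- The map that sends `i` to `B` and fixes the other vertices. -/
noncomputable def mergeMap (B i : V) (h : B ≠ i) (v : V) : {v : V // v ≠ i} :=
  if hv : v = i then ⟨B, h⟩ else ⟨v, hv⟩

/-- The graph in which the vertex `i` is merged into the vertex `B`. -/
def merge (T : SimpleGraph V) (B i : V) : SimpleGraph {v : V // v ≠ i} where
  Adj u v := u ≠ v ∧ (T.Adj u v ∨ (u.1 = B ∧ T.Adj i v) ∨ (v.1 = B ∧ T.Adj i u))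
  symm := ⟨by
    rintro u v ⟨h, h'⟩
    refine ⟨h.symm, ?_⟩
    rcases h' with h' | h' | h'
    · exact Or.inl h'.symm
    · exact Or.inr (Or.inr h')
    · exact Or.inr (Or.inl h')⟩
  loopless := ⟨fun u h => h.1 rfl⟩

theorem mergeMap_self {B i : V} (h : B ≠ i) : mergeMap B i h i = ⟨B, h⟩ := by
  simp [mergeMap]

theorem mergeMap_of_ne {B i : V} (h : B ≠ i) {v : V} (hv : v ≠ i) :
    mergeMap B i h v = ⟨v, hv⟩ := by
  simp [mergeMap, hv]

theorem merge_adj_mergeMap {T : SimpleGraph V} {B i : V} (h : B ≠ i) {u v : V}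
    (huv : T.Adj u v) (hne : mergeMap B i h u ≠ mergeMap B i h v) :
    (T.merge B i).Adj (mergeMap B i h u) (mergeMap B i h v) := by
  refine ⟨hne, ?_⟩
  by_cases hu : u = i
  · subst hu
    have hv : v ≠ u := huv.ne'
    rw [mergeMap_self, mergeMap_of_ne h hv]
    exact Or.inr (Or.inl ⟨rfl, huv⟩)
  · by_cases hv : v = i
    · subst hv
      rw [mergeMap_self, mergeMap_of_ne h hu]
      exact Or.inr (Or.inr ⟨rfl, huv.symm⟩)
    · rw [mergeMap_of_ne h hu, mergeMap_of_ne h hv]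
      exact Or.inl huv

theorem exists_walk_merge {T : SimpleGraph V} {B i : V} (h : B ≠ i) {u v : V} (p : T.Walk u v) :
    ∃ q : (T.merge B i).Walk (mergeMap B i h u) (mergeMap B i h v), q.length ≤ p.length := by
  induction p with
  | nil => exact ⟨Walk.nil, le_rfl⟩
  | @cons u v w huv p ih =>
    obtain ⟨q, hq⟩ := ih
    by_cases hne : mergeMap B i h u = mergeMap B i h v
    · rw [hne]
      exact ⟨q, hq.trans (by simp)⟩
    · exact ⟨Walk.cons (merge_adj_mergeMap h huv hne) q, by simpa using hq⟩

theorem Connected.merge {T : SimpleGraph V} (hT : T.Connected) {B i : V} (h : B ≠ i) :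
    (T.merge B i).Connected := by
  have : Nonempty {v : V // v ≠ i} := ⟨⟨B, h⟩⟩
  refine ⟨fun u v => ?_⟩
  obtain ⟨p⟩ := hT.preconnected u.1 v.1
  obtain ⟨q, -⟩ := exists_walk_merge h p
  rw [mergeMap_of_ne h u.2, mergeMap_of_ne h v.2] at q
  exact ⟨q⟩

/-- Walks project to the contraction, possibly losing steps. This is the direction needed for upper
bounds on negative powers of distances. -/
theorem Connected.dist_merge_le {T : SimpleGraph V} (hT : T.Connected) {B i : V} (h : B ≠ i)
    (u v : V) : (T.merge B i).dist (mergeMap B i h u) (mergeMap B i h v) ≤ T.dist u v := by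
  obtain ⟨p, hp⟩ := hT.exists_walk_length_eq_dist u v
  obtain ⟨q, hq⟩ := exists_walk_merge h p
  exact (dist_le q).trans (hq.trans hp.le)

theorem IsAcyclic.not_adj_of_adj_of_adj {T : SimpleGraph V} (hT : T.IsAcyclic) {a b c : V}
    (hab : T.Adj a b) (hbc : T.Adj b c) : ¬ T.Adj a c := by
  intro hac
  refine hT (Walk.cons hab (Walk.cons hbc (Walk.cons hac.symm Walk.nil))) ?_
  rw [Walk.isCycle_def]
  have := hab.ne
  have := hbc.ne
  have := hac.ne
  simp [Walk.isTrail_def]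
  grind

variable [Fintype V]

open Classical in
theorem isTree_of_connected_of_sum_degree {T : SimpleGraph V} (hT : T.Connected)
    (h : ∑ v, T.degree v + 2 = 2 * Fintype.card V) : T.IsTree := by
  rw [isTree_iff_connected_and_card]
  refine ⟨hT, ?_⟩
  rw [sum_degrees_eq_twice_card_edges] at h
  rw [Nat.card_eq_fintype_card, Nat.card_eq_fintype_card, ← edgeFinset_card]
  omega

open Classical in
theorem IsTree.sum_degree {T : SimpleGraph V} (hT : T.IsTree) :
    ∑ v, T.degree v + 2 = 2 * Fintype.card V := by
  rw [sum_degrees_eq_twice_card_edges, ← hT.card_edgeFinset]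
  ring

-- Without triangles `v` is not adjacent to both `B` and `i`, so no two of its edges are identified.
open Classical in
theorem degree_merge_of_ne {T : SimpleGraph V} (hT : T.IsAcyclic) {B i : V} (hBi : T.Adj B i)
    (v : {v : V // v ≠ i}) (hv : v.1 ≠ B) : (T.merge B i).degree v = T.degree v.1 := by
  symm
  rw [← card_neighborFinset_eq_degree, ← card_neighborFinset_eq_degree]
  refine Finset.card_bij (fun a _ => mergeMap B i hBi.ne a) ?_ ?_ ?_
  · intro a ha
    rw [mem_neighborFinset] at ha ⊢
    have := merge_adj_mergeMap hBi.ne ha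
    rw [mergeMap_of_ne hBi.ne v.2] at this
    refine this ?_
    intro h
    by_cases hai : a = i
    · subst hai
      rw [mergeMap_self] at h
      exact hv (congrArg Subtype.val h)
    · rw [mergeMap_of_ne _ hai] at h
      exact ha.ne (congrArg Subtype.val h)
  · intro a ha b hb hab
    rw [mem_neighborFinset] at ha hb
    by_cases hai : a = i <;> by_cases hbi : b = i
    · rw [hai, hbi]
    · subst hai
      rw [mergeMap_self, mergeMap_of_ne _ hbi, Subtype.mk.injEq] at hab
      subst hab
      exact absurd ha (hT.not_adj_of_adj_of_adj hb hBi)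
    · subst hbi
      rw [mergeMap_self, mergeMap_of_ne _ hai, Subtype.mk.injEq] at hab
      subst hab
      exact absurd hb (hT.not_adj_of_adj_of_adj ha hBi)
    · rw [mergeMap_of_ne _ hai, mergeMap_of_ne _ hbi, Subtype.mk.injEq] at hab
      exact hab
  · intro a ha
    rw [mem_neighborFinset] at ha
    rcases ha.2 with h | h | h
    · exact ⟨a.1, by simpa using h, mergeMap_of_ne _ a.2⟩
    · exact absurd h.1 hv
    · refine ⟨i, by simpa using h.2.symm, ?_⟩
      rw [mergeMap_self]
      exact Subtype.ext h.1.symm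

open Classical in
theorem map_neighborFinset_merge {T : SimpleGraph V} {B i : V} (hBi : T.Adj B i) :
    ((T.merge B i).neighborFinset ⟨B, hBi.ne⟩).map (Function.Embedding.subtype _) =
      (T.neighborFinset B).erase i ∪ (T.neighborFinset i).erase B := by
  ext a
  simp only [Finset.mem_map, mem_neighborFinset, Function.Embedding.subtype_apply,
    Finset.mem_union, Finset.mem_erase]
  constructor
  · rintro ⟨a, ⟨hne, h⟩, rfl⟩
    have hne' : a.1 ≠ B := fun h => hne (Subtype.ext h.symm)
    rcases h with h | h | h
    · exact Or.inl ⟨a.2, h⟩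
    · exact Or.inr ⟨hne', h.2⟩
    · exact absurd h.1 hne'
  · rintro (⟨h1, h2⟩ | ⟨h1, h2⟩)
    · exact ⟨⟨a, h1⟩, ⟨fun h => h2.ne (congrArg Subtype.val h), Or.inl h2⟩, rfl⟩
    · exact ⟨⟨a, h2.ne'⟩, ⟨fun h => h1 (congrArg Subtype.val h).symm, Or.inr (Or.inl ⟨rfl, h2⟩)⟩, rfl⟩

theorem IsAcyclic.disjoint_neighborFinset [DecidableEq V] {T : SimpleGraph V}
    [DecidableRel T.Adj] (hT : T.IsAcyclic) {B i : V}
    (hBi : T.Adj B i) :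
    Disjoint ((T.neighborFinset B).erase i) ((T.neighborFinset i).erase B) := by
  rw [Finset.disjoint_left]
  intro a ha hb
  simp only [Finset.mem_erase, mem_neighborFinset] at ha hb
  exact hT.not_adj_of_adj_of_adj hBi hb.2 ha.2

-- The neighbourhoods of `B` and `i` are disjoint, and each loses the other endpoint of the
-- contracted edge.
open Classical in
theorem degree_merge_self {T : SimpleGraph V} (hT : T.IsAcyclic) {B i : V} (hBi : T.Adj B i) :
    (T.merge B i).degree ⟨B, hBi.ne⟩ + 2 = T.degree B + T.degree i := by
  have h := congrArg Finset.card (map_neighborFinset_merge hBi)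
  rw [Finset.card_map, card_neighborFinset_eq_degree,
    Finset.card_union_of_disjoint (hT.disjoint_neighborFinset hBi),
    Finset.card_erase_of_mem (by simpa using hBi),
    Finset.card_erase_of_mem (by simpa using hBi.symm), card_neighborFinset_eq_degree,
    card_neighborFinset_eq_degree] at h
  have h1 : 0 < T.degree B := (T.degree_pos_iff_exists_adj B).2 ⟨i, hBi⟩
  have h2 : 0 < T.degree i := (T.degree_pos_iff_exists_adj i).2 ⟨B, hBi.symm⟩
  omega

open Classical in
/-- The trees on `V` in which every vertex `v` has degree `d v + 1`. -/
noncomputable def treesOfDegree (d : V → ℕ) : Finset (SimpleGraph V) :=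
  Finset.univ.filter fun T => T.IsTree ∧ ∀ v, T.degree v = d v + 1

open Classical in
theorem mem_treesOfDegree {d : V → ℕ} {T : SimpleGraph V} :
    T ∈ treesOfDegree d ↔ T.IsTree ∧ ∀ v, T.degree v = d v + 1 := by
  simp [treesOfDegree]

theorem sum_add_two_of_mem_treesOfDegree {d : V → ℕ} {T : SimpleGraph V}
    (hT : T ∈ treesOfDegree d) : ∑ v, d v + 2 = Fintype.card V := by
  classical
  rw [mem_treesOfDegree] at hT
  have h := hT.1.sum_degree
  simp only [hT.2, Finset.sum_add_distrib, Finset.sum_const, Finset.card_univ, smul_eq_mul,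
    mul_one] at h
  omega

open Classical in
/-- The degrees after merging `i` into `B`. -/
noncomputable def mergeDegree (d : V → ℕ) (B i : V) (v : {v : V // v ≠ i}) : ℕ :=
  if v.1 = B then d B + d i - 1 else d v.1

open Classical in
theorem merge_mem_treesOfDegree {d : V → ℕ} {T : SimpleGraph V} (hT : T ∈ treesOfDegree d)
    {B i : V} (hBi : T.Adj B i) (hV : 3 ≤ Fintype.card V) :
    T.merge B i ∈ treesOfDegree (mergeDegree d B i) ∧ 1 ≤ d B + d i := by
  rw [mem_treesOfDegree] at hT
  have hc := hT.1.1.merge hBi.ne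
  have hcard : Fintype.card {v : V // v ≠ i} = Fintype.card V - 1 := by
    rw [Fintype.card_subtype_compl, Fintype.card_subtype_eq]
  have hB := degree_merge_self hT.1.2 hBi
  -- A third vertex guarantees an edge at the merged vertex, so the subtraction in `mergeDegree`
  -- does not truncate.
  have hpos : 0 < (T.merge B i).degree ⟨B, hBi.ne⟩ := by
    have : Nontrivial {v : V // v ≠ i} := Fintype.one_lt_card_iff_nontrivial.1 (by omega)
    exact hc.preconnected.degree_pos_of_nontrivial _
  rw [hT.2, hT.2] at hB
  have hdeg : ∀ v, (T.merge B i).degree v = mergeDegree d B i v + 1 := by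
    intro v
    unfold mergeDegree
    split_ifs with hv
    · have : v = ⟨B, hBi.ne⟩ := Subtype.ext hv
      subst this
      omega
    · rw [degree_merge_of_ne hT.1.2 hBi v hv, hT.2]
  refine ⟨mem_treesOfDegree.2 ⟨isTree_of_connected_of_sum_degree hc ?_, hdeg⟩, by omega⟩
  have h := hT.1.sum_degree
  have hs : ∑ v, T.degree v = T.degree i + ∑ v : {v : V // v ≠ i}, T.degree v.1 := by
    rw [Fintype.sum_eq_add_sum_compl i, Finset.sum_subtype ({i}ᶜ) (p := (· ≠ i)) (by simp)]
  have hs1 := Fintype.sum_eq_add_sum_compl (⟨B, hBi.ne⟩ : {v : V // v ≠ i})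
    (fun v => T.degree v.1)
  have hs2 := Fintype.sum_eq_add_sum_compl (⟨B, hBi.ne⟩ : {v : V // v ≠ i})
    (fun v => (T.merge B i).degree v)
  have hs3 : ∑ v ∈ ({⟨B, hBi.ne⟩}ᶜ : Finset {v : V // v ≠ i}), (T.merge B i).degree v =
      ∑ v ∈ ({⟨B, hBi.ne⟩}ᶜ : Finset {v : V // v ≠ i}), T.degree v.1 := by
    refine Finset.sum_congr rfl fun v hv => degree_merge_of_ne hT.1.2 hBi v fun h => ?_
    simp only [Finset.mem_compl, Finset.mem_singleton] at hv
    exact hv (Subtype.ext h)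
  have hB' := hT.2 B
  have hi' := hT.2 i
  simp only at hs1 hs2
  omega

open Classical in
/-- A tree is determined by the result of merging `i` into `B` and the other neighbours of `B`. -/
theorem eq_of_merge_eq {T₁ T₂ : SimpleGraph V} (h₁ : T₁.IsAcyclic) (h₂ : T₂.IsAcyclic) {B i : V}
    (a₁ : T₁.Adj B i) (a₂ : T₂.Adj B i) (hm : T₁.merge B i = T₂.merge B i)
    (hn : (T₁.neighborFinset B).erase i = (T₂.neighborFinset B).erase i) : T₁ = T₂ := by
  have hB : ∀ v, T₁.Adj B v ↔ T₂.Adj B v := by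
    intro v
    by_cases hv : v = i
    · subst hv; exact iff_of_true a₁ a₂
    · have := congrArg (v ∈ ·) hn
      simpa [hv] using this
  -- The neighbours of the merged vertex are shared out between `B` and `i`; those not claimed by
  -- `B` belong to `i`.
  have key : ∀ {T : SimpleGraph V}, T.IsAcyclic → T.Adj B i → ∀ v, v ≠ B → (hv : v ≠ i) →
      (T.Adj i v ↔ (T.merge B i).Adj ⟨B, a₁.ne⟩ ⟨v, hv⟩ ∧ ¬ T.Adj B v) := by
    intro T hT hBi v hvB hv
    constructor
    · intro h
      exact ⟨⟨fun h => hvB (congrArg Subtype.val h).symm, Or.inr (Or.inl ⟨rfl, h⟩)⟩,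
        hT.not_adj_of_adj_of_adj hBi h⟩
    · rintro ⟨⟨-, h | h | h⟩, h'⟩
      · exact absurd h h'
      · exact h.2
      · exact absurd h.1 hvB
  have hi : ∀ v, T₁.Adj i v ↔ T₂.Adj i v := by
    intro v
    by_cases hv : v = i
    · subst hv; simp
    · by_cases hvB : v = B
      · subst hvB; exact iff_of_true a₁.symm a₂.symm
      · rw [key h₁ a₁ v hvB hv, key h₂ a₂ v hvB hv, hm, hB]
  have key2 : ∀ {T : SimpleGraph V}, ∀ u v, u ≠ B → v ≠ B → (hu : u ≠ i) → (hv : v ≠ i) →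
      (T.Adj u v ↔ (T.merge B i).Adj ⟨u, hu⟩ ⟨v, hv⟩) := by
    intro T u v hu hv hu' hv'
    constructor
    · intro h
      exact ⟨fun e => h.ne (congrArg Subtype.val e), Or.inl h⟩
    · rintro ⟨-, h | h | h⟩
      · exact h
      · exact absurd h.1 hu
      · exact absurd h.1 hv
  ext u v
  by_cases hu : u = B
  · subst hu; exact hB v
  by_cases hv : v = B
  · subst hv; rw [T₁.adj_comm, T₂.adj_comm]; exact hB u
  by_cases hu' : u = i
  · subst hu'; exact hi v
  by_cases hv' : v = i
  · subst hv'; rw [T₁.adj_comm, T₂.adj_comm]; exact hi u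
  rw [key2 u v hu hv hu' hv', key2 u v hu hv hu' hv', hm]

end Merge

end SimpleGraph

namespace SimpleGraph

/-! ### Counting the trees with a given contraction -/

section MergeSum

variable {V : Type*}

theorem Connected.exists_adj_dist_add_one {T : SimpleGraph V} (hT : T.Connected) {u z : V}
    (h : u ≠ z) : ∃ i, T.Adj u i ∧ T.dist i z + 1 = T.dist u z := by
  obtain ⟨p, hp⟩ := hT.exists_walk_length_eq_dist u z
  cases p with
  | nil => exact absurd rfl h
  | @cons _ i _ hi q =>
    refine ⟨i, hi, ?_⟩
    have h1 := dist_le q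
    have h2 := hT.dist_triangle (u := u) (v := i) (w := z)
    rw [dist_eq_one_iff_adj.2 hi] at h2
    rw [Walk.length_cons] at hp
    omega

/-- A geodesic to `z` that starts closer to `z` than the merged vertex never visits that vertex, so
all its edges are edges of `T`. -/
theorem Connected.dist_le_dist_merge {T : SimpleGraph V} (hT : T.Connected) {B i : V}
    (h : B ≠ i) (z : {v : V // v ≠ i}) (n : ℕ) :
    ∀ u : {v : V // v ≠ i}, (T.merge B i).dist u z = n → n < (T.merge B i).dist ⟨B, h⟩ z →
      T.dist u z ≤ n := by
  have hc := hT.merge h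
  induction n with
  | zero =>
    intro u hu _
    rw [hc.dist_eq_zero_iff] at hu
    simp [hu]
  | succ n ih =>
    intro u hu hB
    have huz : u ≠ z := by
      rintro rfl
      simp at hu
    obtain ⟨j, hj, hjz⟩ := hc.exists_adj_dist_add_one huz
    have h1 := ih j (by omega) (by omega)
    have hadj : T.Adj u j := by
      rcases hj.2 with h' | h' | h'
      · exact h'
      · have : u = ⟨B, h⟩ := Subtype.ext h'.1
        subst this
        omega
      · have : j = ⟨B, h⟩ := Subtype.ext h'.1
        subst this
        omega
    have h2 := hT.dist_triangle (u := u.1) (v := j.1) (w := z.1)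
    rw [dist_eq_one_iff_adj.2 hadj] at h2
    omega

/-- After merging the neighbour of `B` nearest to `z`, the next vertex on the way to `z` was not
a neighbour of `B`. -/
theorem Connected.not_adj_of_dist_merge {T : SimpleGraph V} (hT : T.Connected) {B i z : V}
    (hBi : T.Adj B i) (hz : T.dist i z + 1 = T.dist B z) (hzi : z ≠ i) (j : {v : V // v ≠ i})
    (hj : (T.merge B i).dist j ⟨z, hzi⟩ + 1 = (T.merge B i).dist ⟨B, hBi.ne⟩ ⟨z, hzi⟩) :
    ¬ T.Adj B j := by
  intro hadj
  -- These bounds put `j` at `T`-distance at most `T.dist B z - 2` from `z`, impossible for a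
  -- neighbour of `B`.
  have h1 := hT.dist_merge_le hBi.ne i z
  rw [mergeMap_self, mergeMap_of_ne _ hzi] at h1
  have h2 := hT.dist_le_dist_merge hBi.ne ⟨z, hzi⟩ _ j rfl (by omega)
  have h3 := hT.dist_triangle (u := B) (v := j.1) (w := z)
  rw [dist_eq_one_iff_adj.2 hadj] at h3
  simp only at h2
  omega

variable [Fintype V]

-- By `eq_of_merge_eq`, a tree in the fibre is encoded by the `d B` neighbours of `B` other than
-- `i`.
open Classical in
theorem card_le_choose_of_merge_eq {d : V → ℕ} {B i : V} (T' : SimpleGraph {v : V // v ≠ i})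
    (𝒯 : Finset (SimpleGraph V)) (h𝒯 : ∀ T ∈ 𝒯, T ∈ treesOfDegree d ∧ T.Adj B i ∧ T.merge B i = T')
    (U : Finset V) (hU : ∀ T ∈ 𝒯, (T.neighborFinset B).erase i ⊆ U) :
    𝒯.card ≤ U.card.choose (d B) := by
  rw [← Finset.card_powersetCard]
  refine Finset.card_le_card_of_injOn (fun T => (T.neighborFinset B).erase i) ?_ ?_
  · intro T hT
    rw [Finset.mem_coe, Finset.mem_powersetCard]
    refine ⟨hU T hT, ?_⟩
    rw [Finset.card_erase_of_mem (by simpa using (h𝒯 T hT).2.1), card_neighborFinset_eq_degree,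
      (mem_treesOfDegree.1 (h𝒯 T hT).1).2]
    rfl
  · intro T₁ h₁ T₂ h₂ h
    obtain ⟨t₁, a₁, m₁⟩ := h𝒯 T₁ h₁
    obtain ⟨t₂, a₂, m₂⟩ := h𝒯 T₂ h₂
    exact eq_of_merge_eq (mem_treesOfDegree.1 t₁).1.2 (mem_treesOfDegree.1 t₂).1.2 a₁ a₂
      (m₁.trans m₂.symm) h

open Classical in
theorem card_neighborFinset_merge {d : V → ℕ} {T : SimpleGraph V} (hT : T ∈ treesOfDegree d)
    {B i : V} (hBi : T.Adj B i) (hV : 3 ≤ Fintype.card V) :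
    (((T.merge B i).neighborFinset ⟨B, hBi.ne⟩).map (Function.Embedding.subtype _)).card =
      d B + d i := by
  obtain ⟨h, h'⟩ := merge_mem_treesOfDegree hT hBi hV
  rw [Finset.card_map, card_neighborFinset_eq_degree, (mem_treesOfDegree.1 h).2]
  simp [mergeDegree]
  omega

open Classical in
theorem sum_merge_le (d : V → ℕ) {B i : V} (hV : 3 ≤ Fintype.card V)
    (𝒯 : Finset (SimpleGraph V)) (h𝒯 : ∀ T ∈ 𝒯, T ∈ treesOfDegree d ∧ T.Adj B i) (c : ℕ)
    (hc : ∀ T', (𝒯.filter fun T => T.merge B i = T').card ≤ c)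
    (g : SimpleGraph {v : V // v ≠ i} → ℝ) (hg : ∀ T', 0 ≤ g T') :
    ∑ T ∈ 𝒯, g (T.merge B i) ≤ c * ∑ T' ∈ treesOfDegree (mergeDegree d B i), g T' := by
  rw [← Finset.sum_fiberwise_of_maps_to (t := treesOfDegree (mergeDegree d B i))
    (g := fun T => T.merge B i)
    (fun T hT => (merge_mem_treesOfDegree (h𝒯 T hT).1 (h𝒯 T hT).2 hV).1), Finset.mul_sum]
  refine Finset.sum_le_sum fun T' _ => ?_
  rw [Finset.sum_congr rfl (g := fun _ => g T')
    (fun T hT => by rw [(Finset.mem_filter.1 hT).2]), Finset.sum_const, nsmul_eq_mul]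
  exact mul_le_mul_of_nonneg_right (by exact_mod_cast hc T') (hg T')

-- Undoing the contraction means choosing which `d B` of the `d B + d i` neighbours of the merged
-- vertex return to `B`. The one leading to `z` must return to `i`, which leaves `d B + d i - 1`
-- candidates.
open Classical in
theorem sum_merge_toward_le (d : V → ℕ) {B i z : V} (hzi : z ≠ i) (hzB : z ≠ B)
    (hV : 3 ≤ Fintype.card V)
    (g : SimpleGraph {v : V // v ≠ i} → ℝ) (hg : ∀ T', 0 ≤ g T') :
    ∑ T ∈ (treesOfDegree d).filter (fun T => T.Adj B i ∧ T.dist i z + 1 = T.dist B z),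
      g (T.merge B i) ≤
      (d B + d i - 1).choose (d B) * ∑ T' ∈ treesOfDegree (mergeDegree d B i), g T' := by
  refine sum_merge_le d hV _ (fun T hT => ?_) _ (fun T' => ?_) g hg
  · rw [Finset.mem_filter] at hT
    exact ⟨hT.1, hT.2.1⟩
  · set 𝒯 := ((treesOfDegree d).filter
      (fun T => T.Adj B i ∧ T.dist i z + 1 = T.dist B z)).filter fun T => T.merge B i = T' with h𝒯
    rcases 𝒯.eq_empty_or_nonempty with h0 | ⟨T₀, hT₀⟩
    · simp [h0]
    have hmem : ∀ T ∈ 𝒯, T ∈ treesOfDegree d ∧ T.Adj B i ∧ T.merge B i = T' ∧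
        T.dist i z + 1 = T.dist B z := by
      intro T hT
      rw [h𝒯, Finset.mem_filter, Finset.mem_filter] at hT
      tauto
    obtain ⟨t₀, a₀, m₀, -⟩ := hmem T₀ hT₀
    have hBi := a₀.ne
    have hconn : T'.Connected :=
      m₀ ▸ (mem_treesOfDegree.1 (merge_mem_treesOfDegree t₀ a₀ hV).1).1.1
    -- `j` depends on `T'` only, so the same vertex is excluded for every tree of the fibre.
    obtain ⟨j, hj, hjz⟩ := hconn.exists_adj_dist_add_one (u := ⟨B, hBi⟩) (z := ⟨z, hzi⟩)
      (fun h => hzB (congrArg Subtype.val h).symm)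
    set U := (T'.neighborFinset ⟨B, hBi⟩).map (Function.Embedding.subtype _) with hU
    have hcard : U.card = d B + d i := by
      subst m₀
      exact card_neighborFinset_merge t₀ a₀ hV
    have hjU : j.1 ∈ U := by
      rw [hU, Finset.mem_map]
      exact ⟨j, by simpa using hj, rfl⟩
    have := card_le_choose_of_merge_eq T' 𝒯
      (fun T hT => ⟨(hmem T hT).1, (hmem T hT).2.1, (hmem T hT).2.2.1⟩) (U.erase j.1) ?_
    · rwa [Finset.card_erase_of_mem hjU, hcard] at this
    · intro T hT
      obtain ⟨t, a, m, hd⟩ := hmem T hT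
      subst m
      rw [Finset.subset_erase]
      constructor
      · rw [hU, map_neighborFinset_merge a]
        exact Finset.subset_union_left
      · intro hmemj
        have h1 := Connected.not_adj_of_dist_merge (mem_treesOfDegree.1 t).1.1 a hd hzi j hjz
        simp only [Finset.mem_erase, mem_neighborFinset] at hmemj
        exact h1 hmemj.2

-- With a leaf at one end of the contracted edge, all neighbours of the merged vertex return to the
-- same side, so there is at most one preimage.
open Classical in
theorem sum_merge_leaf_le (d : V → ℕ) {B i : V} (h0 : d B = 0 ∨ d i = 0)
    (hV : 3 ≤ Fintype.card V)
    (g : SimpleGraph {v : V // v ≠ i} → ℝ) (hg : ∀ T', 0 ≤ g T') :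
    ∑ T ∈ (treesOfDegree d).filter (fun T => T.Adj B i), g (T.merge B i) ≤
      ∑ T' ∈ treesOfDegree (mergeDegree d B i), g T' := by
  have key := sum_merge_le d hV ((treesOfDegree d).filter (fun T => T.Adj B i))
    (fun T hT => by simpa using hT) 1 (fun T' => ?_) g hg
  · simpa using key
  set 𝒯 := ((treesOfDegree d).filter (fun T => T.Adj B i)).filter
    fun T => T.merge B i = T' with h𝒯
  rcases 𝒯.eq_empty_or_nonempty with h | ⟨T₀, hT₀⟩
  · simp [h]
  have hmem : ∀ T ∈ 𝒯, T ∈ treesOfDegree d ∧ T.Adj B i ∧ T.merge B i = T' := by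
    intro T hT
    rw [h𝒯, Finset.mem_filter, Finset.mem_filter] at hT
    tauto
  obtain ⟨t₀, a₀, m₀⟩ := hmem T₀ hT₀
  have := card_le_choose_of_merge_eq T' 𝒯 hmem
    ((T'.neighborFinset ⟨B, a₀.ne⟩).map (Function.Embedding.subtype _)) ?_
  · have hcard : ((T'.neighborFinset ⟨B, a₀.ne⟩).map (Function.Embedding.subtype _)).card =
        d B + d i := by
      subst m₀
      exact card_neighborFinset_merge t₀ a₀ hV
    rw [hcard] at this
    rcases h0 with h0 | h0 <;> simpa [h0] using this
  · intro T hT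
    obtain ⟨t, a, m⟩ := hmem T hT
    subst m
    rw [map_neighborFinset_merge a]
    exact Finset.subset_union_left

/-- The number of trees on `V` with `d v` children at every `v`, in closed form. -/
noncomputable def treeCount (d : V → ℕ) : ℝ :=
  ((Fintype.card V - 2).factorial : ℝ) / ∏ v, ((d v).factorial : ℝ)

theorem treeCount_pos (d : V → ℕ) : 0 < treeCount d := by
  unfold treeCount
  have : 0 < ∏ v, ((d v).factorial : ℝ) := Finset.prod_pos fun v _ => by positivity
  positivity

-- `R` collects the factorials at the vertices untouched by the contraction, and cancels in every
-- ratio.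
open Classical in
theorem treeCount_mergeDegree (d : V → ℕ) {B i : V} (h : B ≠ i) (hV : 3 ≤ Fintype.card V) :
    ∃ R : ℝ, 0 < R ∧ treeCount d = (Fintype.card V - 2).factorial / ((d i).factorial *
        ((d B).factorial * R)) ∧
      treeCount (mergeDegree d B i) =
        (Fintype.card V - 3).factorial / ((d B + d i - 1).factorial * R) := by
  refine ⟨∏ v : {v : {v : V // v ≠ i} // v ≠ ⟨B, h⟩}, ((d v.1.1).factorial : ℝ),
    Finset.prod_pos fun v _ => by positivity, ?_, ?_⟩
  · rw [treeCount, Fintype.prod_eq_mul_prod_subtype_ne _ i,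
      Fintype.prod_eq_mul_prod_subtype_ne _ (⟨B, h⟩ : {v : V // v ≠ i})]
  · rw [treeCount, Fintype.prod_eq_mul_prod_subtype_ne _ (⟨B, h⟩ : {v : V // v ≠ i})]
    have hc : Fintype.card {v : V // v ≠ i} - 2 = Fintype.card V - 3 := by
      rw [Fintype.card_subtype_compl, Fintype.card_subtype_eq]
      omega
    rw [hc]
    congr 1
    · congr 1
      · simp [mergeDegree]
      · refine Finset.prod_congr rfl fun v _ => ?_
        have : v.1.1 ≠ B := fun hv => v.2 (Subtype.ext hv)
        simp [mergeDegree, this]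

-- The binomial number of preimages, times the ratio of the closed counts, is exactly `d i / (card V
-- - 2)`: the next vertex of the path is chosen in a size-biased way, whatever the degree of `B`.
open Classical in
theorem sum_merge_toward_le_of_le (d : V → ℕ) {B i z : V} (hBi : B ≠ i) (hzi : z ≠ i)
    (hzB : z ≠ B) (hV : 3 ≤ Fintype.card V) (g : SimpleGraph {v : V // v ≠ i} → ℝ)
    (hg : ∀ T', 0 ≤ g T') (X : ℝ) (hX : 0 ≤ X)
    (h : ∑ T' ∈ treesOfDegree (mergeDegree d B i), g T' ≤ treeCount (mergeDegree d B i) * X) :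
    ∑ T ∈ (treesOfDegree d).filter (fun T => T.Adj B i ∧ T.dist i z + 1 = T.dist B z),
      g (T.merge B i) ≤ treeCount d * (d i / ((Fintype.card V : ℝ) - 2)) * X := by
  have hV' : (0 : ℝ) < (Fintype.card V : ℝ) - 2 := by
    have : (3 : ℝ) ≤ Fintype.card V := by exact_mod_cast hV
    linarith
  have hpos' := treeCount_pos d
  rcases Finset.eq_empty_or_nonempty ((treesOfDegree d).filter
    (fun T => T.Adj B i ∧ T.dist i z + 1 = T.dist B z)) with h0 | ⟨T₀, hT₀⟩
  · rw [h0, Finset.sum_empty]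
    positivity
  rw [Finset.mem_filter] at hT₀
  have hpos := (merge_mem_treesOfDegree hT₀.1 hT₀.2.1 hV).2
  refine (sum_merge_toward_le d hzi hzB hV g hg).trans ?_
  refine (mul_le_mul_of_nonneg_left h (by positivity)).trans ?_
  rw [← mul_assoc]
  refine mul_le_mul_of_nonneg_right (le_of_eq ?_) hX
  obtain ⟨R, hR, e1, e2⟩ := treeCount_mergeDegree d hBi hV
  rw [e1, e2]
  rcases Nat.eq_zero_or_pos (d i) with hi | hi
  · rw [hi, Nat.choose_eq_zero_of_lt (by omega)]
    simp
  obtain ⟨m, hm⟩ := Nat.exists_eq_add_of_le' hi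
  obtain ⟨s, hs⟩ := Nat.exists_eq_add_of_le' hV
  have hch := Nat.add_choose_mul_factorial_mul_factorial (d B) m
  rw [← Nat.choose_symm_add] at hch
  have hch' : ((d B + m).choose (d B) : ℝ) * (d B).factorial * m.factorial =
      (d B + m).factorial := by exact_mod_cast hch
  rw [hm, hs, show d B + (m + 1) - 1 = d B + m by omega, show s + 3 - 2 = s + 1 by omega,
    show s + 3 - 3 = s by omega, Nat.factorial_succ, Nat.factorial_succ, ← hch']
  have hc : (0 : ℝ) < (d B + m).choose (d B) := by
    exact_mod_cast Nat.choose_pos (by omega)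
  push_cast
  have : (s : ℝ) + 3 - 2 ≠ 0 := by have := s.cast_nonneg (α := ℝ); linarith
  field_simp
  ring

-- Here the binomial coefficient is 1 and one of the two degrees vanishes, so the ratio of the
-- closed counts becomes `(d B + d i) / (card V - 2)`.
open Classical in
theorem sum_merge_leaf_le_of_le (d : V → ℕ) {B i : V} (hBi : B ≠ i) (h0 : d B = 0 ∨ d i = 0)
    (hV : 3 ≤ Fintype.card V) (g : SimpleGraph {v : V // v ≠ i} → ℝ)
    (hg : ∀ T', 0 ≤ g T') (X : ℝ) (hX : 0 ≤ X)
    (h : ∑ T' ∈ treesOfDegree (mergeDegree d B i), g T' ≤ treeCount (mergeDegree d B i) * X) :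
    ∑ T ∈ (treesOfDegree d).filter (fun T => T.Adj B i), g (T.merge B i) ≤
      treeCount d * (((d B : ℝ) + d i) / ((Fintype.card V : ℝ) - 2)) * X := by
  have hV' : (0 : ℝ) < (Fintype.card V : ℝ) - 2 := by
    have : (3 : ℝ) ≤ Fintype.card V := by exact_mod_cast hV
    linarith
  have hpos' := treeCount_pos d
  rcases Finset.eq_empty_or_nonempty ((treesOfDegree d).filter (fun T => T.Adj B i))
    with he | ⟨T₀, hT₀⟩
  · rw [he, Finset.sum_empty]
    positivity
  rw [Finset.mem_filter] at hT₀
  have hpos := (merge_mem_treesOfDegree hT₀.1 hT₀.2 hV).2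
  refine (sum_merge_leaf_le d h0 hV g hg).trans (h.trans ?_)
  refine mul_le_mul_of_nonneg_right (le_of_eq ?_) hX
  obtain ⟨R, hR, e1, e2⟩ := treeCount_mergeDegree d hBi hV
  rw [e1, e2]
  obtain ⟨s, hs⟩ := Nat.exists_eq_add_of_le' hV
  have hs' : (s : ℝ) + 3 - 2 ≠ 0 := by have := s.cast_nonneg (α := ℝ); linarith
  obtain ⟨m, hm⟩ := Nat.exists_eq_add_of_le' hpos
  have hm' : (d B : ℝ) + d i = m + 1 := by exact_mod_cast hm
  have hf : ((d i).factorial : ℝ) * (d B).factorial = (m + 1).factorial := by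
    rcases h0 with h0 | h0
    · rw [h0, zero_add] at hm
      simp [h0, hm]
    · rw [h0, add_zero] at hm
      simp [h0, hm]
  rw [← mul_assoc, hf, hm', hm, hs, show m + 1 - 1 = m by omega, show s + 3 - 2 = s + 1 by omega,
    show s + 3 - 3 = s by omega, Nat.factorial_succ, Nat.factorial_succ]
  push_cast
  field_simp
  ring

open Classical in
theorem exists_eq_zero_of_mem_treesOfDegree {d : V → ℕ} (h : ∑ v, d v + 2 = Fintype.card V) :
    ∃ x, d x = 0 := by
  by_contra! hne
  have : ∑ v : V, 1 ≤ ∑ v, d v := Finset.sum_le_sum fun v _ => Nat.one_le_iff_ne_zero.2 (hne v)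
  simp at this
  omega

-- Induction by contracting the edge at a leaf `x`: its neighbour is `i` with weight `d i / (card V
-- - 2)`, and these weights sum to at most 1.
open Classical in
theorem card_treesOfDegree_le (n : ℕ) : ∀ (V : Type) [Fintype V] (d : V → ℕ), Fintype.card V = n →
    ((treesOfDegree d).card : ℝ) ≤ treeCount d := by
  induction n with
  | zero =>
    intro V _ d hV
    rcases (treesOfDegree d).eq_empty_or_nonempty with h | ⟨T, hT⟩
    · rw [h]
      simpa using (treeCount_pos d).le
    · have := sum_add_two_of_mem_treesOfDegree hT
      omega
  | succ n ih =>
    intro V _ d hV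
    rcases (treesOfDegree d).eq_empty_or_nonempty with h | ⟨T, hT⟩
    · rw [h]
      simpa using (treeCount_pos d).le
    have hsum := sum_add_two_of_mem_treesOfDegree hT
    obtain ⟨x, hx⟩ := exists_eq_zero_of_mem_treesOfDegree hsum
    by_cases h3 : 3 ≤ Fintype.card V
    · have hs : (0 : ℝ) < (Fintype.card V : ℝ) - 2 := by
        have : (3 : ℝ) ≤ Fintype.card V := by exact_mod_cast h3
        linarith
      have h1 : ((treesOfDegree d).card : ℝ) ≤ ∑ i ∈ Finset.univ.erase x,
          ((((treesOfDegree d).filter fun T => T.Adj x i).card : ℕ) : ℝ) := by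
        have hsub : treesOfDegree d ⊆ (Finset.univ.erase x).biUnion
            fun i => (treesOfDegree d).filter fun T => T.Adj x i := by
          intro T hT
          have hdeg := (mem_treesOfDegree.1 hT).2 x
          obtain ⟨i, hi⟩ := (T.degree_pos_iff_exists_adj x).1 (by omega)
          simp only [Finset.mem_biUnion, Finset.mem_erase, Finset.mem_filter]
          exact ⟨i, ⟨hi.ne', Finset.mem_univ _⟩, hT, hi⟩
        exact_mod_cast (Finset.card_le_card hsub).trans Finset.card_biUnion_le
      refine h1.trans ?_
      have h2 : ∀ i ∈ Finset.univ.erase x,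
          ((((treesOfDegree d).filter fun T => T.Adj x i).card : ℕ) : ℝ) ≤
          treeCount d * (d i / ((Fintype.card V : ℝ) - 2)) := by
        intro i hi
        have hxi : x ≠ i := (Finset.ne_of_mem_erase hi).symm
        have := sum_merge_leaf_le_of_le d hxi (Or.inl hx) h3 (fun _ => 1) (fun _ => zero_le_one) 1
          zero_le_one (by
            have := ih {v : V // v ≠ i} (mergeDegree d x i) (by
              rw [Fintype.card_subtype_compl, Fintype.card_subtype_eq]
              omega)
            simpa using this)
        simpa [hx] using this
      refine (Finset.sum_le_sum h2).trans ?_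
      rw [← Finset.mul_sum, ← Finset.sum_div]
      have h4 : ∑ i ∈ Finset.univ.erase x, (d i : ℝ) ≤ (Fintype.card V : ℝ) - 2 := by
        rw [← hsum]
        push_cast
        have := Finset.sum_le_sum_of_subset_of_nonneg (Finset.erase_subset x Finset.univ)
          (fun i _ _ => (d i).cast_nonneg (α := ℝ))
        linarith
      have h5 : (∑ i ∈ Finset.univ.erase x, (d i : ℝ)) / ((Fintype.card V : ℝ) - 2) ≤ 1 :=
        (div_le_one hs).2 h4
      exact mul_le_of_le_one_right (treeCount_pos d).le h5
    · have h2 : Fintype.card V = 2 := by omega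
      have hd : ∀ v, d v = 0 := by
        have : ∑ v, d v = 0 := by omega
        simpa using this
      have hone : (treesOfDegree d).card ≤ 1 := by
        rw [Finset.card_le_one]
        have htop : ∀ T ∈ treesOfDegree d, T = ⊤ := by
          intro T hT
          rw [eq_top_iff_forall_ne_adj]
          intro u v huv
          obtain ⟨i, hi⟩ := (T.degree_pos_iff_exists_adj u).1 (by
            rw [(mem_treesOfDegree.1 hT).2 u]; omega)
          by_cases hiv : i = v
          · exact hiv ▸ hi
          · have := Finset.card_le_univ ({u, v, i} : Finset V)
            rw [Finset.card_eq_three.2 ⟨u, v, i, huv, hi.ne, Ne.symm hiv, rfl⟩] at this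
            omega
        intro T₁ h₁ T₂ h₂
        rw [htop T₁ h₁, htop T₂ h₂]
      have hF : treeCount d = 1 := by simp [treeCount, h2, hd]
      rw [hF]
      exact_mod_cast hone

end MergeSum

end SimpleGraph

/-! ### Estimates for one step of the size-biased exploration -/

/-- The weight `n ^ (-3/2)` of a pair of leaves at distance `n`. -/
noncomputable def distWeight (n : ℕ) : ℝ := (n : ℝ) ^ (-(3 / 2) : ℝ)

theorem distWeight_nonneg (n : ℕ) : 0 ≤ distWeight n := by
  unfold distWeight; positivity

theorem distWeight_anti {m n : ℕ} (hm : 0 < m) (h : m ≤ n) : distWeight n ≤ distWeight m :=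
  Real.rpow_le_rpow_of_nonpos (by exact_mod_cast hm) (by exact_mod_cast h) (by norm_num)

/-- The graph lies below its chord on `[0, 1]`, whose slope `e - 1` is less than 2. -/
theorem Real.exp_le_one_add_two_mul {y : ℝ} (h0 : 0 ≤ y) (h1 : y ≤ 1) :
    Real.exp y ≤ 1 + 2 * y := by
  have h := convexOn_exp.2 (Set.mem_univ (0 : ℝ)) (Set.mem_univ (1 : ℝ)) (sub_nonneg.2 h1) h0
    (by ring)
  simp only [smul_eq_mul, mul_zero, mul_one, zero_add, Real.exp_zero] at h
  have he := Real.exp_one_lt_d9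
  nlinarith

/-- The factor in the bound for the explorations that reach their goal in `t + 1` steps from a
vertex with `b` children. -/
noncomputable def chainFactor (q M b : ℝ) (t : ℕ) : ℝ :=
  (b + 3 * q ^ 2 / M * t) * Real.exp (b / q) * (1 + 3 * q / M) ^ t / M

theorem chainFactor_nonneg {q M b : ℝ} (hq : 0 < q) (hM : 0 < M) (hb : 0 ≤ b) (t : ℕ) :
    0 ≤ chainFactor q M b t := by
  unfold chainFactor; positivity

/-- A step raises `b` by `d i - 1`. As `d i - 1 ≤ q` for `d i > 0`, the exponential can be
linearised, after which only the first two moments of the size-biased choice enter. -/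
theorem sum_mul_exp_le {ι : Type*} (s : Finset ι) (d : ι → ℕ) {u M q b τ : ℝ} (hq : 1 ≤ q)
    (hM : 0 < M) (hMu : M ≤ u) (hb : 0 ≤ b) (hτ : 0 ≤ τ) (h1 : ∑ i ∈ s, (d i : ℝ) ≤ u)
    (h2 : ∑ i ∈ s, (d i : ℝ) * ((d i : ℝ) - 1) ≤ q ^ 2) :
    ∑ i ∈ s, (d i / u) * ((b + d i - 1 + τ) * Real.exp ((b + d i - 1) / q)) ≤
      (b + 3 * q ^ 2 / M + τ) * Real.exp (b / q) * (1 + 3 * q / M) := by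
  have hu : 0 < u := hM.trans_le hMu
  have hq0 : 0 < q := by linarith
  have hnn : ∀ i, 0 ≤ (d i : ℝ) * ((d i : ℝ) - 1) := by
    intro i
    rcases Nat.eq_zero_or_pos (d i) with h | h
    · simp [h]
    · have : (1 : ℝ) ≤ d i := by exact_mod_cast h
      exact mul_nonneg (by linarith) (by linarith)
  have hterm : ∀ i ∈ s, (d i / u) * ((b + d i - 1 + τ) * Real.exp ((b + d i - 1) / q)) ≤
      (Real.exp (b / q) / u) * ((b + τ) * d i +
        (2 * (b + τ) / q + 3) * (d i * ((d i : ℝ) - 1))) := by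
    intro i hi
    rcases Nat.eq_zero_or_pos (d i) with h | h
    · simp [h]
    have hd : (1 : ℝ) ≤ d i := by exact_mod_cast h
    set y := ((d i : ℝ) - 1) / q with hy
    have hy0 : 0 ≤ y := div_nonneg (by linarith) hq0.le
    -- A single term of the second-moment sum gives `(d i - 1)² ≤ d i (d i - 1) ≤ q²`.
    have hy1 : y ≤ 1 := by
      rw [hy, div_le_one hq0]
      have := Finset.single_le_sum (fun i _ => hnn i) hi
      nlinarith
    have hsplit : (b + d i - 1) / q = b / q + y := by rw [hy]; ring
    rw [hsplit, Real.exp_add]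
    have he := Real.exp_le_one_add_two_mul hy0 hy1
    have hexp : (b + d i - 1 + τ) * Real.exp y ≤
        (b + τ) + (2 * (b + τ) / q + 3) * ((d i : ℝ) - 1) := by
      have e1 : (b + τ) * Real.exp y ≤ (b + τ) * (1 + 2 * y) :=
        mul_le_mul_of_nonneg_left he (by linarith)
      have e2 : ((d i : ℝ) - 1) * Real.exp y ≤ ((d i : ℝ) - 1) * 3 :=
        mul_le_mul_of_nonneg_left (by linarith) (by linarith)
      have e3 : (b + τ) * (1 + 2 * y) = (b + τ) + 2 * (b + τ) / q * ((d i : ℝ) - 1) := by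
        rw [hy]; field_simp
      linarith
    calc (d i / u) * ((b + d i - 1 + τ) * (Real.exp (b / q) * Real.exp y))
        = (d i / u * Real.exp (b / q)) * ((b + d i - 1 + τ) * Real.exp y) := by ring
      _ ≤ (d i / u * Real.exp (b / q)) * ((b + τ) + (2 * (b + τ) / q + 3) * ((d i : ℝ) - 1)) :=
        mul_le_mul_of_nonneg_left hexp (by positivity)
      _ = _ := by ring
  refine (Finset.sum_le_sum hterm).trans ?_
  rw [← Finset.mul_sum, Finset.sum_add_distrib, ← Finset.mul_sum, ← Finset.mul_sum]
  have hbt : 0 ≤ b + τ := by linarith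
  calc (Real.exp (b / q) / u) * ((b + τ) * ∑ i ∈ s, (d i : ℝ) +
        (2 * (b + τ) / q + 3) * ∑ i ∈ s, (d i : ℝ) * ((d i : ℝ) - 1))
      ≤ (Real.exp (b / q) / u) * ((b + τ) * u + (2 * (b + τ) / q + 3) * q ^ 2) := by gcongr
    _ = Real.exp (b / q) * ((b + τ) + (2 * (b + τ) * q + 3 * q ^ 2) / u) := by
        field_simp
    _ ≤ Real.exp (b / q) * ((b + τ) + (2 * (b + τ) * q + 3 * q ^ 2) / M) := by gcongr
    _ ≤ Real.exp (b / q) * ((b + 3 * q ^ 2 / M + τ) * (1 + 3 * q / M)) := by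
        gcongr
        have e : (b + 3 * q ^ 2 / M + τ) * (1 + 3 * q / M) -
          ((b + τ) + (2 * (b + τ) * q + 3 * q ^ 2) / M) =
          (b + τ) * q / M + 3 * q ^ 2 / M * (3 * q / M) := by
            field_simp; ring
        have : 0 ≤ (b + τ) * q / M + 3 * q ^ 2 / M * (3 * q / M) := by positivity
        linarith
    _ = _ := by ring

/-- Each step adds `3 q² / M` to the linear factor and multiplies by `1 + 3 q / M`; `chainFactor` is
shaped so that this is exactly the passage from `t` to `t + 1`. -/
theorem sum_chainFactor_le {ι : Type*} (s : Finset ι) (d : ι → ℕ) {u M q b : ℝ} (hq : 1 ≤ q)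
    (hM : 0 < M) (hMu : M ≤ u) (hb : 0 ≤ b) (h1 : ∑ i ∈ s, (d i : ℝ) ≤ u)
    (h2 : ∑ i ∈ s, (d i : ℝ) * ((d i : ℝ) - 1) ≤ q ^ 2) (t : ℕ) :
    ∑ i ∈ s, (d i / u) * chainFactor q M (b + d i - 1) t ≤ chainFactor q M b (t + 1) := by
  have hq0 : 0 < q := by linarith
  have key := sum_mul_exp_le s d (τ := 3 * q ^ 2 / M * t) hq hM hMu hb (by positivity) h1 h2
  have e1 : ∑ i ∈ s, (d i / u) * chainFactor q M (b + d i - 1) t =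
      (∑ i ∈ s, (d i / u) * ((b + d i - 1 + 3 * q ^ 2 / M * t) *
        Real.exp ((b + d i - 1) / q))) * ((1 + 3 * q / M) ^ t / M) := by
    rw [Finset.sum_mul]
    refine Finset.sum_congr rfl fun i _ => ?_
    unfold chainFactor
    ring
  have e2 : chainFactor q M b (t + 1) =
      ((b + 3 * q ^ 2 / M + 3 * q ^ 2 / M * t) * Real.exp (b / q) * (1 + 3 * q / M)) *
        ((1 + 3 * q / M) ^ t / M) := by
    unfold chainFactor
    push_cast
    ring
  rw [e1, e2]
  exact mul_le_mul_of_nonneg_right key (by positivity)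

/-- Raise the exponent to the integer `2k` and keep one term of the exponential series. With `y = b
/ q` this explains the factor `exp (b / q)` in `chainFactor`. -/
theorem one_add_rpow_le_exp {y : ℝ} (hy : 0 ≤ y) (k : ℕ) :
    (1 + y) ^ (3 / 2 * k : ℝ) ≤ (2 * k).factorial * Real.exp 1 * Real.exp y := by
  have h1 : (1 + y) ^ (3 / 2 * k : ℝ) ≤ (1 + y) ^ (2 * k) := by
    rw [← Real.rpow_natCast]
    refine Real.rpow_le_rpow_of_exponent_le (by linarith) ?_
    push_cast
    have := k.cast_nonneg (α := ℝ)
    linarith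
  have h2 := Real.pow_div_factorial_le_exp (1 + y) (by linarith) (2 * k)
  rw [div_le_iff₀ (by positivity), Real.exp_add] at h2
  linarith

/-! ### Sums over trees of products of pair weights -/

namespace SimpleGraph

section Chain

/-- The product of the weights of the pairs `(L 0, L 1), …, (L (2k-2), L (2k-1))`. -/
noncomputable def pairWeight {V : Type*} (T : SimpleGraph V) (L : ℕ → V) (k : ℕ) : ℝ :=
  ∏ j ∈ Finset.range k, distWeight (T.dist (L (2 * j)) (L (2 * j + 1)))

theorem pairWeight_nonneg {V : Type*} (T : SimpleGraph V) (L : ℕ → V) (k : ℕ) :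
    0 ≤ pairWeight T L k := Finset.prod_nonneg fun _ _ => distWeight_nonneg _

/-- The first `2k` terms of `L` are distinct leaves. -/
def PairLeaves {V : Type*} (d : V → ℕ) (L : ℕ → V) (k : ℕ) : Prop :=
  (∀ a < 2 * k, d (L a) = 0) ∧ Set.InjOn L (Set.Iio (2 * k))

theorem mergeMap_injOn {V : Type*} {B i : V} (h : B ≠ i) :
    Set.InjOn (mergeMap B i h) {v | v ≠ i} := by
  intro u hu v hv huv
  rw [mergeMap_of_ne h hu, mergeMap_of_ne h hv] at huv
  exact congrArg Subtype.val huv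

theorem PairLeaves.merge {V : Type*} {d : V → ℕ} {L : ℕ → V} {k : ℕ} (hL : PairLeaves d L k)
    {B i : V} (h : B ≠ i) (hB : ∀ a < 2 * k, L a ≠ B) (hi : ∀ a < 2 * k, L a ≠ i) :
    PairLeaves (mergeDegree d B i) (mergeMap B i h ∘ L) k := by
  constructor
  · intro a ha
    rw [Function.comp, mergeMap_of_ne h (hi a ha)]
    simp [mergeDegree, hB a ha, hL.1 a ha]
  · intro a ha b hb hab
    exact hL.2 ha hb (mergeMap_injOn h (hi a ha) (hi b hb) hab)

/-- Paired leaves must stay distinct after the contraction: `distWeight 0 = 0`, so monotonicity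
fails at distance zero. -/
theorem Connected.pairWeight_le_merge {V : Type*} {T : SimpleGraph V} (hT : T.Connected)
    {d : V → ℕ} {L : ℕ → V} {k : ℕ} (hL : PairLeaves d L k)
    {B i : V} (h : B ≠ i) (hi : ∀ a < 2 * k, L a ≠ i) :
    pairWeight T L k ≤ pairWeight (T.merge B i) (mergeMap B i h ∘ L) k := by
  refine Finset.prod_le_prod (fun _ _ => distWeight_nonneg _) fun j hj => ?_
  rw [Finset.mem_range] at hj
  refine distWeight_anti ?_ (hT.dist_merge_le h _ _)
  refine (hT.merge h).pos_dist_of_ne fun he => ?_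
  have := mergeMap_injOn h (hi (2 * j) (by omega)) (hi (2 * j + 1) (by omega)) he
  have := hL.2 (Set.mem_Iio.2 (by omega)) (Set.mem_Iio.2 (by omega)) this
  omega

/-- The bound for `k` pairs of leaves, with constant `C`. -/
def PairBound (k : ℕ) (C : ℝ) : Prop :=
  ∀ (V : Type) [Fintype V] (d : V → ℕ) (L : ℕ → V) (q : ℝ), 1 ≤ q →
    ∑ v, (d v : ℝ) * ((d v : ℝ) - 1) ≤ q ^ 2 → PairLeaves d L k →
    ∑ T ∈ treesOfDegree d, pairWeight T L k ≤
      treeCount d * (C * (q / Fintype.card V) ^ (3 / 2 * k : ℝ))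

-- A leaf `i ≠ z` is not on the way to `z`; here this is read off from the binomial coefficient `(d
-- B - 1).choose (d B) = 0`.
open Classical in
theorem filter_toward_eq_empty {V : Type*} [Fintype V] {d : V → ℕ} {B i z : V} (hzi : z ≠ i)
    (hzB : z ≠ B) (hV : 3 ≤ Fintype.card V) (hi : d i = 0) :
    (treesOfDegree d).filter (fun T => T.Adj B i ∧ T.dist i z + 1 = T.dist B z) = ∅ := by
  by_contra hne
  obtain ⟨T, hT⟩ := Finset.nonempty_iff_ne_empty.2 hne
  have hT' := Finset.mem_filter.1 hT
  have hpos := (merge_mem_treesOfDegree hT'.1 hT'.2.1 hV).2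
  have := sum_merge_toward_le d hzi hzB hV (fun _ => 1) (fun _ => zero_le_one)
  rw [hi, add_zero, Nat.choose_eq_zero_of_lt (by omega)] at this
  simp only [Finset.sum_const, nsmul_eq_mul, mul_one, Nat.cast_zero, zero_mul] at this
  have h0 : 0 < ((treesOfDegree d).filter
    (fun T => T.Adj B i ∧ T.dist i z + 1 = T.dist B z)).card := Finset.card_pos.2 ⟨T, hT⟩
  have h1 : (0 : ℝ) < ((treesOfDegree d).filter
    (fun T => T.Adj B i ∧ T.dist i z + 1 = T.dist B z)).card := by exact_mod_cast h0
  linarith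

-- The degree of `B` grows along the exploration, so the second-moment hypothesis leaves `B` out; in
-- this form it survives every contraction.
open Classical in
theorem sum_mergeDegree_off {V : Type*} [Fintype V] (d : V → ℕ) {B i : V} (hBi : B ≠ i) :
    ∑ v, (if v = (⟨B, hBi⟩ : {v : V // v ≠ i}) then (0 : ℝ) else
      (mergeDegree d B i v : ℝ) * ((mergeDegree d B i v : ℝ) - 1)) + d i * ((d i : ℝ) - 1) =
    ∑ v, (if v = B then (0 : ℝ) else (d v : ℝ) * ((d v : ℝ) - 1)) := by
  rw [Fintype.sum_eq_add_sum_subtype_ne _ i, if_neg hBi.symm, add_comm]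
  congr 1
  refine Finset.sum_congr rfl fun v _ => ?_
  by_cases hv : v.1 = B
  · rw [if_pos (Subtype.ext hv), if_pos hv]
  · rw [if_neg (fun h => hv (congrArg Subtype.val h)), if_neg hv]
    simp [mergeDegree, hv]

theorem natCast_mul_sub_one_nonneg (n : ℕ) : (0 : ℝ) ≤ n * ((n : ℝ) - 1) := by
  rcases Nat.eq_zero_or_pos n with h | h
  · simp [h]
  · have : (1 : ℝ) ≤ n := by exact_mod_cast h
    exact mul_nonneg (by linarith) (by linarith)

open Classical in
/-- The contribution of the trees in which the vertex `z` is adjacent to `B`. -/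
theorem sum_adj_le {k : ℕ} {C : ℝ} (hC : 0 ≤ C) (IH : PairBound k C) {M q : ℝ}
    (hM : 1 ≤ M) (hq : 1 ≤ q) {V : Type} [Fintype V] (d : V → ℕ) (L : ℕ → V) {B z : V}
    (hV : M + 2 ≤ Fintype.card V) (hBz : B ≠ z) (hz : d z = 0) (hL : PairLeaves d L k)
    (hLB : ∀ a < 2 * k, L a ≠ B) (hLz : ∀ a < 2 * k, L a ≠ z)
    (hsum : ∑ v, (if v = B then (0 : ℝ) else (d v : ℝ) * ((d v : ℝ) - 1)) ≤ q ^ 2) :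
    ∑ T ∈ (treesOfDegree d).filter (fun T => T.Adj B z), pairWeight T L k ≤
      treeCount d * ((C * ((2 * k).factorial * Real.exp 1) * (q / M) ^ (3 / 2 * k : ℝ)) *
        chainFactor q M (d B) 0) := by
  have hV3 : 3 ≤ Fintype.card V := by
    have : (3 : ℝ) ≤ Fintype.card V := by linarith
    exact_mod_cast this
  have hM0 : 0 < M := by linarith
  have hq0 : 0 < q := by linarith
  set b : ℝ := (d B : ℝ) with hb
  have hb0 : 0 ≤ b := by positivity
  have hL' := hL.merge hBz hLB hLz
  have hcard : (Fintype.card {v : V // v ≠ z} : ℝ) = Fintype.card V - 1 := by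
    rw [Fintype.card_subtype_compl, Fintype.card_subtype_eq, Nat.cast_sub (by omega)]
    simp
  -- The induction hypothesis needs the moment over all vertices. The cluster contributes at most
  -- `b²`, hence the parameter `q + b` instead of `q`.
  have hq' : ∑ v, (mergeDegree d B z v : ℝ) * ((mergeDegree d B z v : ℝ) - 1) ≤ (q + b) ^ 2 := by
    have h1 := sum_mergeDegree_off d hBz
    have h2 : ∑ v, (mergeDegree d B z v : ℝ) * ((mergeDegree d B z v : ℝ) - 1) ≤
        b ^ 2 + ∑ v, (if v = (⟨B, hBz⟩ : {v : V // v ≠ z}) then (0 : ℝ) else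
          (mergeDegree d B z v : ℝ) * ((mergeDegree d B z v : ℝ) - 1)) := by
      rw [Fintype.sum_eq_add_sum_subtype_ne _ (⟨B, hBz⟩ : {v : V // v ≠ z}),
        Fintype.sum_eq_add_sum_subtype_ne (fun v => if v = (⟨B, hBz⟩ : {v : V // v ≠ z}) then _
          else _) (⟨B, hBz⟩ : {v : V // v ≠ z}), if_pos rfl, zero_add]
      refine add_le_add ?_ (Finset.sum_le_sum fun v _ => by rw [if_neg v.2])
      have h3 : (mergeDegree d B z ⟨B, hBz⟩ : ℝ) ≤ b := by
        rw [hb]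
        exact_mod_cast (by simp [mergeDegree, hz] : mergeDegree d B z ⟨B, hBz⟩ ≤ d B)
      have h4 : (0 : ℝ) ≤ mergeDegree d B z ⟨B, hBz⟩ := by positivity
      nlinarith
    have h5 := natCast_mul_sub_one_nonneg (d z)
    nlinarith
  have h1 := IH _ (mergeDegree d B z) _ (q + b) (by linarith) hq' hL'
  have hX : 0 ≤ C * ((q + b) / Fintype.card {v : V // v ≠ z}) ^ (3 / 2 * k : ℝ) := by positivity
  have h2 := sum_merge_leaf_le_of_le d hBz (Or.inr hz) hV3 _ (fun T' => pairWeight_nonneg T' _ k) _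
    hX h1
  have h3 : ∑ T ∈ (treesOfDegree d).filter (fun T => T.Adj B z), pairWeight T L k ≤
      ∑ T ∈ (treesOfDegree d).filter (fun T => T.Adj B z),
        pairWeight (T.merge B z) (mergeMap B z hBz ∘ L) k := by
    refine Finset.sum_le_sum fun T hT => ?_
    rw [Finset.mem_filter, mem_treesOfDegree] at hT
    exact hT.1.1.1.pairWeight_le_merge hL hBz hLz
  refine h3.trans (h2.trans ?_)
  rw [mul_assoc]
  refine mul_le_mul_of_nonneg_left ?_ (treeCount_pos d).le
  rw [hz, hcard, Nat.cast_zero, add_zero]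
  have h4 : b / ((Fintype.card V : ℝ) - 2) ≤ b / M := by gcongr; linarith
  -- The cost of replacing `q` by `q + b` is absorbed into `exp (b / q)`.
  have h5 : ((q + b) / ((Fintype.card V : ℝ) - 1)) ^ (3 / 2 * k : ℝ) ≤
      (q / M) ^ (3 / 2 * k : ℝ) * ((2 * k).factorial * Real.exp 1 * Real.exp (b / q)) := by
    have e1 : ((q + b) / ((Fintype.card V : ℝ) - 1)) ≤ (q / M) * (1 + b / q) := by
      have : (q / M) * (1 + b / q) = (q + b) / M := by field_simp
      rw [this]
      gcongr
      linarith
    refine (Real.rpow_le_rpow (div_nonneg (by linarith) (by linarith)) e1 (by positivity)).trans ?_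
    rw [Real.mul_rpow (by positivity) (by positivity)]
    exact mul_le_mul_of_nonneg_left (one_add_rpow_le_exp (by positivity) k) (by positivity)
  calc b / ((Fintype.card V : ℝ) - 2) *
        (C * ((q + b) / ((Fintype.card V : ℝ) - 1)) ^ (3 / 2 * k : ℝ))
      ≤ b / M * (C * ((q / M) ^ (3 / 2 * k : ℝ) *
        ((2 * k).factorial * Real.exp 1 * Real.exp (b / q)))) := by
        gcongr
        have : 0 ≤ (q + b) / ((Fintype.card V : ℝ) - 1) :=
          div_nonneg (by linarith) (by linarith)
        positivity
    _ = _ := by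
        unfold chainFactor
        simp
        ring

end Chain

end SimpleGraph

namespace SimpleGraph

section Chain

theorem _root_.Finset.sum_le_sum_sum_filter {α ι : Type*} (s : Finset α) (t : Finset ι)
    (P : ι → α → Prop) [∀ i, DecidablePred (P i)] (f : α → ℝ) (hf : ∀ a, 0 ≤ f a)
    (h : ∀ a ∈ s, ∃ i ∈ t, P i a) : ∑ a ∈ s, f a ≤ ∑ i ∈ t, ∑ a ∈ s.filter (P i), f a := by
  simp only [Finset.sum_filter]
  rw [Finset.sum_comm]
  refine Finset.sum_le_sum fun a ha => ?_
  obtain ⟨i, hi, hP⟩ := h a ha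
  have := Finset.single_le_sum (f := fun i => if P i a then f a else 0) (fun i _ => by
    split_ifs
    · exact hf a
    · exact le_rfl) hi
  simpa [hP] using this

open Classical in
/-- The bound for the trees in which `z` is at distance at most `n` from `B`. -/
theorem sum_dist_le_of_pairBound {k : ℕ} {C : ℝ} (hC : 0 ≤ C) (IH : PairBound k C) {M q : ℝ}
    (hM : 1 ≤ M) (hq : 1 ≤ q) (n : ℕ) : ∀ (V : Type) [Fintype V] (d : V → ℕ) (L : ℕ → V) (B z : V)
    (l : ℕ), M + 1 + n ≤ Fintype.card V → B ≠ z → d z = 0 → PairLeaves d L k →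
    (∀ a < 2 * k, L a ≠ B) → (∀ a < 2 * k, L a ≠ z) →
    ∑ v, (if v = B then (0 : ℝ) else (d v : ℝ) * ((d v : ℝ) - 1)) ≤ q ^ 2 →
    ∑ T ∈ treesOfDegree d,
      (if T.dist B z ≤ n then distWeight (l + T.dist B z) * pairWeight T L k else 0) ≤
      treeCount d * ((C * ((2 * k).factorial * Real.exp 1) * (q / M) ^ (3 / 2 * k : ℝ)) *
        ∑ t ∈ Finset.range n, distWeight (l + t + 1) * chainFactor q M (d B) t) := by
  set A := C * ((2 * k).factorial * Real.exp 1) * (q / M) ^ (3 / 2 * k : ℝ) with hA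
  have hM0 : 0 < M := by linarith
  have hq0 : 0 < q := by linarith
  have hA0 : 0 ≤ A := by positivity
  induction n with
  | zero =>
    intro V _ d L B z l hV hBz hz hL hLB hLz hsum
    simp only [Finset.range_zero, Finset.sum_empty, mul_zero]
    refine (Finset.sum_eq_zero fun T hT => if_neg ?_).le
    have := (mem_treesOfDegree.1 hT).1.1.pos_dist_of_ne hBz
    omega
  | succ n ih =>
    intro V _ d L B z l hV hBz hz hL hLB hLz hsum
    push_cast at hV
    have hn0 := n.cast_nonneg (α := ℝ)
    have hV3 : 3 ≤ Fintype.card V := by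
      have : (3 : ℝ) ≤ Fintype.card V := by linarith
      exact_mod_cast this
    have hu : 0 < (Fintype.card V : ℝ) - 2 := by linarith
    set f : SimpleGraph V → ℝ := fun T =>
      if T.dist B z ≤ n + 1 then distWeight (l + T.dist B z) * pairWeight T L k else 0 with hf
    have hf0 : ∀ T, 0 ≤ f T := by
      intro T
      simp only [hf]
      split_ifs
      · exact mul_nonneg (distWeight_nonneg _) (pairWeight_nonneg _ _ _)
      · exact le_rfl
    rcases (treesOfDegree d).eq_empty_or_nonempty with hempty | ⟨T₀, hT₀⟩
    · rw [hempty, Finset.sum_empty]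
      refine mul_nonneg (treeCount_pos d).le (mul_nonneg hA0 (Finset.sum_nonneg fun t _ =>
        mul_nonneg (distWeight_nonneg _) (chainFactor_nonneg hq0 hM0 (by positivity) _)))
    have hdsum := sum_add_two_of_mem_treesOfDegree hT₀
    set P : V → Finset (SimpleGraph V) := fun i =>
      (treesOfDegree d).filter (fun T => T.Adj B i ∧ T.dist i z + 1 = T.dist B z) with hP
    -- The trees are sorted by the first vertex `i` on the path from `B` to `z`; the path ends at
    -- once if `i = z`.
    have hunion : ∑ T ∈ treesOfDegree d, f T ≤ ∑ i ∈ Finset.univ.erase B, ∑ T ∈ P i, f T := by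
      refine Finset.sum_le_sum_sum_filter _ _ _ f hf0 fun T hT => ?_
      obtain ⟨i, hi, hiz⟩ := (mem_treesOfDegree.1 hT).1.1.exists_adj_dist_add_one hBz
      exact ⟨i, Finset.mem_erase.2 ⟨hi.ne', Finset.mem_univ _⟩, hi, hiz⟩
    refine hunion.trans ?_
    set u : ℝ := (Fintype.card V : ℝ) - 2 with hu'
    have hz_part : ∑ T ∈ P z, f T ≤
        treeCount d * (A * (distWeight (l + 1) * chainFactor q M (d B) 0)) := by
      have h1 : ∑ T ∈ P z, f T ≤ ∑ T ∈ (treesOfDegree d).filter (fun T => T.Adj B z),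
          distWeight (l + 1) * pairWeight T L k := by
        refine (Finset.sum_le_sum_of_subset_of_nonneg (t := (treesOfDegree d).filter
          (fun T => T.Adj B z)) ?_ fun T _ _ => hf0 T).trans (Finset.sum_le_sum ?_)
        · intro T hT
          simp only [hP, Finset.mem_filter] at hT ⊢
          exact ⟨hT.1, hT.2.1⟩
        · intro T hT
          rw [Finset.mem_filter] at hT
          simp only [hf]
          rw [dist_eq_one_iff_adj.2 hT.2, if_pos (by omega)]
      refine h1.trans ?_
      rw [← Finset.mul_sum]
      refine (mul_le_mul_of_nonneg_left
        (sum_adj_le hC IH hM hq d L (by linarith) hBz hz hL hLB hLz hsum)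
        (distWeight_nonneg _)).trans (le_of_eq ?_)
      rw [← hA]
      ring
    have hi_part : ∀ i ∈ Finset.univ.erase B, i ≠ z → ∑ T ∈ P i, f T ≤
        treeCount d * (d i / u) * (A * ∑ t ∈ Finset.range n,
          distWeight (l + 1 + t + 1) * chainFactor q M (d B + d i - 1) t) := by
      intro i hi hiz
      have hBi : B ≠ i := (Finset.ne_of_mem_erase hi).symm
      rcases Nat.eq_zero_or_pos (d i) with hdi | hdi
      · rw [show P i = ∅ from filter_toward_eq_empty hiz.symm hBz.symm hV3 hdi, hdi]
        simp
      have hLi : ∀ a < 2 * k, L a ≠ i := by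
        rintro a ha rfl
        have := hL.1 a ha
        omega
      have hdeg : (mergeDegree d B i ⟨B, hBi⟩ : ℝ) = d B + d i - 1 := by
        simp only [mergeDegree, if_true]
        rw [Nat.cast_sub (by omega)]
        push_cast
        ring
      have hcard : (Fintype.card {v : V // v ≠ i} : ℝ) = Fintype.card V - 1 := by
        rw [Fintype.card_subtype_compl, Fintype.card_subtype_eq, Nat.cast_sub (by omega)]
        simp
      have hX0 : 0 ≤ A * ∑ t ∈ Finset.range n,
          distWeight (l + 1 + t + 1) * chainFactor q M (d B + d i - 1) t := by
        refine mul_nonneg hA0 (Finset.sum_nonneg fun t _ =>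
          mul_nonneg (distWeight_nonneg _) (chainFactor_nonneg hq0 hM0 ?_ _))
        rw [← hdeg]
        positivity
      -- The offset `l` counts the path edges already contracted, so that the weight still refers to
      -- the full distance.
      have h1 := ih {v : V // v ≠ i} (mergeDegree d B i) (mergeMap B i hBi ∘ L) ⟨B, hBi⟩
        ⟨z, hiz.symm⟩ (l + 1) (by rw [hcard]; linarith)
        (fun h => hBz (congrArg Subtype.val h)) (by simp [mergeDegree, hBz.symm, hz])
        (hL.merge hBi hLB hLi)
        (by
          intro a ha h
          rw [Function.comp, mergeMap_of_ne _ (hLi a ha)] at h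
          exact hLB a ha (congrArg Subtype.val h))
        (by
          intro a ha h
          rw [Function.comp, mergeMap_of_ne _ (hLi a ha)] at h
          exact hLz a ha (congrArg Subtype.val h))
        (by
          have := sum_mergeDegree_off d hBi
          have h5 := natCast_mul_sub_one_nonneg (d i)
          refine le_trans (le_of_eq ?_) ((le_add_of_nonneg_right h5).trans (this.le.trans hsum))
          refine Finset.sum_congr rfl fun v _ => ?_
          congr)
      rw [hdeg] at h1
      have h2 := sum_merge_toward_le_of_le d hBi hiz.symm hBz.symm hV3 _ (fun T' => by
        split_ifs
        · exact mul_nonneg (distWeight_nonneg _) (pairWeight_nonneg _ _ _)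
        · exact le_rfl) _ hX0 h1
      refine le_trans (Finset.sum_le_sum fun T hT => ?_) h2
      simp only [hP, Finset.mem_filter] at hT
      obtain ⟨hT, hadj, hd⟩ := hT
      have hconn := (mem_treesOfDegree.1 hT).1.1
      have hle := hconn.dist_merge_le hBi i z
      rw [mergeMap_self, mergeMap_of_ne _ hiz.symm] at hle
      simp only [hf]
      by_cases hdn : T.dist B z ≤ n + 1
      · rw [if_pos hdn, if_pos (by omega)]
        refine mul_le_mul (distWeight_anti (by omega) (by omega))
          (hconn.pairWeight_le_merge hL hBi hLi) (pairWeight_nonneg _ _ _) (distWeight_nonneg _)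
      · rw [if_neg hdn]
        split_ifs
        · exact mul_nonneg (distWeight_nonneg _) (pairWeight_nonneg _ _ _)
        · exact le_rfl
    have hzmem : z ∈ Finset.univ.erase B := by simp [hBz.symm]
    have hsd : ∑ i ∈ (Finset.univ.erase B).erase z, (d i : ℝ) ≤ u := by
      have h1 : ∑ i ∈ (Finset.univ.erase B).erase z, (d i : ℝ) ≤ ∑ i, (d i : ℝ) :=
        Finset.sum_le_sum_of_subset_of_nonneg (Finset.subset_univ _) fun _ _ _ => by positivity
      have h2 : (∑ i, (d i : ℝ)) + 2 = Fintype.card V := by exact_mod_cast hdsum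
      linarith
    have hsdd : ∑ i ∈ (Finset.univ.erase B).erase z, (d i : ℝ) * ((d i : ℝ) - 1) ≤ q ^ 2 := by
      refine le_trans ?_ hsum
      rw [Finset.sum_congr rfl (g := fun v => if v = B then (0 : ℝ) else
        (d v : ℝ) * ((d v : ℝ) - 1))]
      · refine Finset.sum_le_sum_of_subset_of_nonneg (Finset.subset_univ _) fun v _ _ => ?_
        split_ifs
        · exact le_rfl
        · exact natCast_mul_sub_one_nonneg _
      · intro v hv
        rw [if_neg (Finset.ne_of_mem_erase (Finset.mem_of_mem_erase hv))]
    rw [← Finset.add_sum_erase _ _ hzmem]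
    have hrest : ∑ i ∈ (Finset.univ.erase B).erase z, ∑ T ∈ P i, f T ≤
        treeCount d * (A * ∑ t ∈ Finset.range n,
          distWeight (l + (t + 1) + 1) * chainFactor q M (d B) (t + 1)) := by
      refine (Finset.sum_le_sum fun i hi => hi_part i (Finset.mem_of_mem_erase hi)
        (Finset.ne_of_mem_erase hi)).trans ?_
      have e : ∑ i ∈ (Finset.univ.erase B).erase z, treeCount d * (d i / u) *
          (A * ∑ t ∈ Finset.range n,
            distWeight (l + 1 + t + 1) * chainFactor q M (d B + d i - 1) t) =
          treeCount d * (A * ∑ t ∈ Finset.range n, distWeight (l + (t + 1) + 1) *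
            ∑ i ∈ (Finset.univ.erase B).erase z,
              (d i / u) * chainFactor q M (d B + d i - 1) t) := by
        simp only [Finset.mul_sum]
        rw [Finset.sum_comm]
        refine Finset.sum_congr rfl fun t _ => Finset.sum_congr rfl fun i _ => ?_
        rw [show l + 1 + t + 1 = l + (t + 1) + 1 by ring]
        ring
      rw [e]
      refine mul_le_mul_of_nonneg_left (mul_le_mul_of_nonneg_left (Finset.sum_le_sum fun t _ =>
        mul_le_mul_of_nonneg_left ?_ (distWeight_nonneg _)) hA0) (treeCount_pos d).le
      exact sum_chainFactor_le _ d hq hM0 (by linarith) (by positivity) hsd hsdd t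
    refine (add_le_add hz_part hrest).trans (le_of_eq ?_)
    -- The term `t = 0` is the case `i = z`; the shifted sum is the contribution of the other
    -- vertices.
    rw [Finset.sum_range_succ']
    simp only [add_zero]
    ring

/-- Each term is at most `1 / √(t + 1)`, which is dominated by an increment of `2 √t`, and the sum
telescopes. -/
theorem sum_distWeight_mul_le (K : ℕ) :
    ∑ t ∈ Finset.range K, distWeight (t + 1) * t ≤ 2 * √K := by
  have hterm : ∀ t : ℕ, distWeight (t + 1) * t ≤ 2 * √(t + 1 : ℕ) - 2 * √(t : ℕ) := by
    intro t
    have ht : (0 : ℝ) ≤ t := t.cast_nonneg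
    have h1 : distWeight (t + 1) * t ≤ (√(t + 1 : ℕ))⁻¹ := by
      have e : (√(t + 1 : ℕ))⁻¹ = distWeight (t + 1) * (t + 1 : ℕ) := by
        unfold distWeight
        rw [Real.sqrt_eq_rpow, ← Real.rpow_neg (by positivity), ← Real.rpow_add_one (by positivity)]
        norm_num
      rw [e]
      exact mul_le_mul_of_nonneg_left (by push_cast; linarith) (distWeight_nonneg _)
    refine h1.trans ?_
    have hs : 0 < √(t + 1 : ℕ) := Real.sqrt_pos.2 (by positivity)
    have hs0 : 0 ≤ √(t : ℕ) := Real.sqrt_nonneg _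
    have e1 : √(t + 1 : ℕ) ^ 2 = t + 1 := by rw [Real.sq_sqrt (by positivity)]; push_cast; ring
    have e2 : √(t : ℕ) ^ 2 = t := Real.sq_sqrt ht
    rw [inv_le_iff_one_le_mul₀ hs]
    nlinarith [sq_nonneg (√(t + 1 : ℕ) - √(t : ℕ))]
  refine (Finset.sum_le_sum fun t _ => hterm t).trans (le_of_eq ?_)
  rw [Finset.sum_range_sub (fun t : ℕ => 2 * √(t : ℕ))]
  simp

/-- Up to the cutoff the geometric factor is at most `e`, so the terms are of order `(q / s)² t · t
^ (-3/2)`. Their sum is of order `(q / s)² √K` with `√K ≤ (q / s) ^ (-1/2)`. -/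
theorem sum_distWeight_mul_chainFactor_le {q s : ℝ} (hq : 0 < q) (hs : 0 < s) :
    ∑ t ∈ Finset.range ⌊s / (8 * q)⌋₊, distWeight (0 + t + 1) * chainFactor q (s / 2) 0 t ≤
      24 * Real.exp 1 * (q / s) ^ (3 / 2 : ℝ) := by
  set K := ⌊s / (8 * q)⌋₊ with hK
  have hKle : (K : ℝ) ≤ s / (8 * q) := Nat.floor_le (by positivity)
  have hx : 0 < q / s := by positivity
  have hterm : ∀ t ∈ Finset.range K, distWeight (0 + t + 1) * chainFactor q (s / 2) 0 t ≤
      (12 * (q / s) ^ 2 * Real.exp 1) * (distWeight (t + 1) * t) := by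
    intro t ht
    have htK : (t : ℝ) ≤ K := by exact_mod_cast (Finset.mem_range.1 ht).le
    have hpow : (1 + 3 * q / (s / 2)) ^ t ≤ Real.exp 1 := by
      have h1 : 1 + 3 * q / (s / 2) ≤ Real.exp (3 * q / (s / 2)) := by
        have := Real.add_one_le_exp (3 * q / (s / 2))
        linarith
      refine (pow_le_pow_left₀ (by positivity) h1 t).trans ?_
      rw [← Real.exp_nat_mul, Real.exp_le_exp]
      calc (t : ℝ) * (3 * q / (s / 2)) ≤ (s / (8 * q)) * (3 * q / (s / 2)) := by
            gcongr
            exact htK.trans hKle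
        _ = 3 / 4 := by field_simp; norm_num
        _ ≤ 1 := by norm_num
    have e : chainFactor q (s / 2) 0 t ≤ 12 * (q / s) ^ 2 * Real.exp 1 * t := by
      unfold chainFactor
      rw [zero_div, Real.exp_zero, mul_one, zero_add]
      calc 3 * q ^ 2 / (s / 2) * t * (1 + 3 * q / (s / 2)) ^ t / (s / 2)
          ≤ 3 * q ^ 2 / (s / 2) * t * Real.exp 1 / (s / 2) := by gcongr
        _ = _ := by field_simp; ring
    rw [zero_add]
    calc distWeight (t + 1) * chainFactor q (s / 2) 0 t
        ≤ distWeight (t + 1) * (12 * (q / s) ^ 2 * Real.exp 1 * t) :=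
          mul_le_mul_of_nonneg_left e (distWeight_nonneg _)
      _ = _ := by ring
  refine (Finset.sum_le_sum hterm).trans ?_
  rw [← Finset.mul_sum]
  refine (mul_le_mul_of_nonneg_left (sum_distWeight_mul_le K) (by positivity)).trans ?_
  have hsq : √(K : ℝ) ≤ (q / s) ^ (-(1 / 2) : ℝ) := by
    rw [Real.rpow_neg hx.le, ← Real.sqrt_eq_rpow, ← Real.sqrt_inv]
    refine Real.sqrt_le_sqrt (hKle.trans ?_)
    rw [inv_div]
    gcongr
    linarith
  calc 12 * (q / s) ^ 2 * Real.exp 1 * (2 * √K)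
      ≤ 12 * (q / s) ^ 2 * Real.exp 1 * (2 * (q / s) ^ (-(1 / 2) : ℝ)) := by gcongr
    _ = 24 * Real.exp 1 * ((q / s) ^ (2 : ℝ) * (q / s) ^ (-(1 / 2) : ℝ)) := by
        rw [Real.rpow_two]; ring
    _ = _ := by rw [← Real.rpow_add hx]; norm_num

open Classical in
/-- The bound for one more pair than in the hypothesis `IH`. -/
theorem PairBound.succ {k : ℕ} {C : ℝ} (hC : 0 ≤ C) (IH : PairBound k C) :
    PairBound (k + 1) (C * ((2 * k).factorial * Real.exp 1) * 2 ^ (3 / 2 * k : ℝ) *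
      (24 * Real.exp 1) + C * 8 ^ (3 / 2 : ℝ)) := by
  intro V _ d L q hq hsum hL
  have hq0 : 0 < q := by linarith
  have hL' : PairLeaves d L k :=
    ⟨fun a ha => hL.1 a (by omega), hL.2.mono (Set.Iio_subset_Iio (by omega))⟩
  have hne : ∀ a < 2 * (k + 1), ∀ b < 2 * (k + 1), a ≠ b → L a ≠ L b :=
    fun a ha b hb hab h => hab (hL.2 ha hb h)
  set B := L (2 * k) with hB
  set z := L (2 * k + 1) with hz
  have hBz : B ≠ z := hne _ (by omega) _ (by omega) (by omega)
  have hs1 : 0 < Fintype.card V := Fintype.card_pos_iff.2 ⟨B⟩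
  set s : ℝ := (Fintype.card V : ℝ) with hs
  have hs0 : 0 < s := Nat.cast_pos.2 hs1
  have hx : 0 < q / s := by positivity
  -- Beyond `K` the weight is at most `(8 q / s) ^ (3/2)`, and the induction hypothesis on the same
  -- tree suffices; only distances up to `K` need the exploration.
  set K := ⌊s / (8 * q)⌋₊ with hK
  have hF := treeCount_pos d
  have hsplit : ∀ T ∈ treesOfDegree d, pairWeight T L (k + 1) ≤
      (if T.dist B z ≤ K then distWeight (0 + T.dist B z) * pairWeight T L k else 0) +
        8 ^ (3 / 2 : ℝ) * (q / s) ^ (3 / 2 : ℝ) * pairWeight T L k := by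
    intro T hT
    have e : pairWeight T L (k + 1) = distWeight (T.dist B z) * pairWeight T L k := by
      rw [pairWeight, Finset.prod_range_succ, mul_comm]
      rfl
    rw [e]
    have hp := pairWeight_nonneg T L k
    split_ifs with h
    · rw [zero_add]
      exact le_add_of_nonneg_right (by positivity)
    · rw [zero_add]
      refine mul_le_mul_of_nonneg_right ?_ hp
      have h1 : s / (8 * q) ≤ T.dist B z := (Nat.lt_of_floor_lt (not_le.1 h)).le
      have h2 : distWeight (T.dist B z) ≤ (s / (8 * q)) ^ (-(3 / 2) : ℝ) :=
        Real.rpow_le_rpow_of_nonpos (by positivity) h1 (by norm_num)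
      refine h2.trans (le_of_eq ?_)
      rw [Real.rpow_neg (by positivity), ← Real.inv_rpow (by positivity),
        ← Real.mul_rpow (by positivity) hx.le]
      congr 1
      field_simp
  refine (Finset.sum_le_sum hsplit).trans ?_
  rw [Finset.sum_add_distrib, ← Finset.mul_sum]
  have hpow : (q / s) ^ (3 / 2 * (k + 1 : ℕ) : ℝ) =
      (q / s) ^ (3 / 2 * k : ℝ) * (q / s) ^ (3 / 2 : ℝ) := by
    rw [← Real.rpow_add hx]
    congr 1
    push_cast
    ring
  have hlong : 8 ^ (3 / 2 : ℝ) * (q / s) ^ (3 / 2 : ℝ) *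
      ∑ T ∈ treesOfDegree d, pairWeight T L k ≤
      treeCount d * (C * 8 ^ (3 / 2 : ℝ) * (q / s) ^ (3 / 2 * (k + 1 : ℕ) : ℝ)) := by
    refine (mul_le_mul_of_nonneg_left (IH V d L q hq hsum hL') (by positivity)).trans
      (le_of_eq ?_)
    rw [hpow]
    ring
  have hshort : ∑ T ∈ treesOfDegree d,
      (if T.dist B z ≤ K then distWeight (0 + T.dist B z) * pairWeight T L k else 0) ≤
      treeCount d * (C * ((2 * k).factorial * Real.exp 1) * 2 ^ (3 / 2 * k : ℝ) *
        (24 * Real.exp 1) * (q / s) ^ (3 / 2 * (k + 1 : ℕ) : ℝ)) := by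
    rcases Nat.eq_zero_or_pos K with hK0 | hK0
    · rw [Finset.sum_eq_zero]
      · positivity
      · intro T hT
        refine if_neg ?_
        have := (mem_treesOfDegree.1 hT).1.1.pos_dist_of_ne hBz
        omega
    have hKle : (K : ℝ) ≤ s / (8 * q) := Nat.floor_le (by positivity)
    have hK1 : (1 : ℝ) ≤ K := by exact_mod_cast hK0
    have hs8 : 8 * q ≤ s := by
      have := hK1.trans hKle
      rwa [one_le_div (by positivity)] at this
    have hKs : (K : ℝ) ≤ s / 8 := by
      refine hKle.trans ?_
      gcongr
      linarith
    -- Since `s ≥ 8` and `K ≤ s / 8`, at most `K` contractions leave enough vertices for `M = s /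
    -- 2`.
    have h1 := sum_dist_le_of_pairBound hC IH (M := s / 2) (by linarith) hq K V d L B z 0
      (by linarith) hBz (hL.1 _ (by omega)) hL' (fun a ha => hne _ (by omega) _ (by omega) (by omega))
      (fun a ha => hne _ (by omega) _ (by omega) (by omega)) (by
        refine le_trans (Finset.sum_le_sum fun v _ => ?_) hsum
        split_ifs
        · exact natCast_mul_sub_one_nonneg _
        · exact le_rfl)
    refine h1.trans (mul_le_mul_of_nonneg_left ?_ hF.le)
    -- `B` is itself a leaf, so the exploration starts with `b = 0`.
    rw [hL.1 _ (by omega), Nat.cast_zero]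
    refine (mul_le_mul_of_nonneg_left (sum_distWeight_mul_chainFactor_le hq0 hs0)
      (by positivity)).trans (le_of_eq ?_)
    rw [hpow, show q / (s / 2) = 2 * (q / s) by field_simp, Real.mul_rpow (by norm_num) hx.le]
    ring
  refine (add_le_add hshort hlong).trans (le_of_eq ?_)
  ring

theorem exists_pairBound (k : ℕ) : ∃ C, 0 ≤ C ∧ PairBound k C := by
  induction k with
  | zero =>
    refine ⟨1, zero_le_one, fun V _ d L q _ _ _ => ?_⟩
    simpa [pairWeight] using card_treesOfDegree_le _ V d rfl
  | succ k ih =>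
    obtain ⟨C, hC, h⟩ := ih
    exact ⟨_, by positivity, h.succ hC⟩

end Chain

end SimpleGraph

/-! ### Attaching a leaf, and the lower bound on the number of trees -/

namespace SimpleGraph

section AddLeaf

variable {V : Type*}

/-- The graph with a leaf `x` attached to the vertex `i`. -/
def addLeaf {x : V} (T : SimpleGraph {v : V // v ≠ x}) (i : {v : V // v ≠ x}) :
    SimpleGraph V where
  Adj u v := (∃ hu hv, T.Adj ⟨u, hu⟩ ⟨v, hv⟩) ∨ (u = x ∧ v = i) ∨ (v = x ∧ u = i)
  symm := ⟨by
    rintro u v (⟨hu, hv, h⟩ | h | h)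
    · exact Or.inl ⟨hv, hu, h.symm⟩
    · exact Or.inr (Or.inr h)
    · exact Or.inr (Or.inl h)⟩
  loopless := ⟨by
    rintro u (⟨hu, hv, h⟩ | h | h)
    · exact h.ne rfl
    · exact i.2 (h.2.symm.trans h.1)
    · exact i.2 (h.2.symm.trans h.1)⟩

variable {x : V}

theorem addLeaf_adj_coe {T : SimpleGraph {v : V // v ≠ x}} {i u v : {v : V // v ≠ x}} :
    (T.addLeaf i).Adj u v ↔ T.Adj u v := by
  constructor
  · rintro (⟨hu, hv, h⟩ | h | h)
    · exact h
    · exact absurd h.1 u.2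
    · exact absurd h.1 v.2
  · exact fun h => Or.inl ⟨u.2, v.2, h⟩

theorem addLeaf_adj_left {T : SimpleGraph {v : V // v ≠ x}} {i : {v : V // v ≠ x}} {v : V} :
    (T.addLeaf i).Adj x v ↔ v = i := by
  constructor
  · rintro (⟨hu, -⟩ | h | h)
    · exact absurd rfl hu
    · exact h.2
    · exact absurd h.2.symm i.2
  · exact fun h => Or.inr (Or.inl ⟨rfl, h⟩)

theorem addLeaf_injective (i : {v : V // v ≠ x}) :
    Function.Injective (fun T : SimpleGraph {v : V // v ≠ x} => T.addLeaf i) := by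
  intro T₁ T₂ h
  ext u v
  rw [← addLeaf_adj_coe (i := i), ← addLeaf_adj_coe (T := T₂) (i := i)]
  exact iff_of_eq (congrArg (fun T : SimpleGraph V => T.Adj u v) h)

theorem Connected.addLeaf {T : SimpleGraph {v : V // v ≠ x}} (hT : T.Connected)
    (i : {v : V // v ≠ x}) : (T.addLeaf i).Connected := by
  have hi : ∀ v, (T.addLeaf i).Reachable i v := by
    intro v
    by_cases hv : v = x
    · subst hv
      exact (addLeaf_adj_left.2 rfl).symm.reachable
    · exact (hT.preconnected i ⟨v, hv⟩).map
        (⟨Subtype.val, fun h => addLeaf_adj_coe.2 h⟩ : T →g T.addLeaf i)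
  have : Nonempty V := ⟨x⟩
  exact ⟨fun u v => (hi u).symm.trans (hi v)⟩

variable [Fintype V]

open Classical in
theorem addLeaf_mem_treesOfDegree {d : V → ℕ} (hx : d x = 0) {T : SimpleGraph {v : V // v ≠ x}}
    {i : {v : V // v ≠ x}} (hi : 1 ≤ d i) (hT : T ∈ treesOfDegree (mergeDegree d i x)) :
    T.addLeaf i ∈ treesOfDegree d := by
  have hsum := sum_add_two_of_mem_treesOfDegree hT
  rw [mem_treesOfDegree] at hT ⊢
  have hdegx : (T.addLeaf i).degree x = 1 := by
    rw [← card_neighborFinset_eq_degree, Finset.card_eq_one]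
    exact ⟨i, by ext v; simp [addLeaf_adj_left]⟩
  have hmap : ∀ v : {v : V // v ≠ x}, v ≠ i → (T.addLeaf i).neighborFinset v.1 =
      (T.neighborFinset v).map (Function.Embedding.subtype _) := by
    intro v hv
    ext u
    simp only [mem_neighborFinset, Finset.mem_map, Function.Embedding.subtype_apply]
    constructor
    · intro h
      have hu : u ≠ x := by
        rintro rfl
        exact hv (Subtype.ext (addLeaf_adj_left.1 h.symm))
      exact ⟨⟨u, hu⟩, addLeaf_adj_coe.1 h, rfl⟩
    · rintro ⟨u, hu, rfl⟩
      exact addLeaf_adj_coe.2 hu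
  have hmapi : (T.addLeaf i).neighborFinset i.1 =
      insert x ((T.neighborFinset i).map (Function.Embedding.subtype _)) := by
    ext u
    simp only [mem_neighborFinset, Finset.mem_insert, Finset.mem_map,
      Function.Embedding.subtype_apply]
    constructor
    · intro h
      by_cases hu : u = x
      · exact Or.inl hu
      · exact Or.inr ⟨⟨u, hu⟩, addLeaf_adj_coe.1 h, rfl⟩
    · rintro (rfl | ⟨u, hu, rfl⟩)
      · exact (addLeaf_adj_left.2 rfl).symm
      · exact addLeaf_adj_coe.2 hu
  have hdeg : ∀ v, (T.addLeaf i).degree v = d v + 1 := by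
    intro v
    by_cases hv : v = x
    · rw [hv, hdegx, hx]
    by_cases hvi : v = i
    · subst hvi
      rw [← card_neighborFinset_eq_degree, hmapi, Finset.card_insert_of_notMem (by simp),
        Finset.card_map, card_neighborFinset_eq_degree, hT.2]
      simp [mergeDegree, hx]
      omega
    · have := hmap ⟨v, hv⟩ (fun h => hvi (congrArg Subtype.val h))
      rw [← card_neighborFinset_eq_degree, this, Finset.card_map, card_neighborFinset_eq_degree,
        hT.2]
      simp [mergeDegree, hvi]
  refine ⟨isTree_of_connected_of_sum_degree (hT.1.1.addLeaf i) ?_, hdeg⟩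
  have h1 : ∑ v, d v = d x + ∑ v : {v : V // v ≠ x}, d v.1 :=
    Fintype.sum_eq_add_sum_subtype_ne _ _
  have h2 := Fintype.sum_eq_add_sum_subtype_ne (fun v : {v : V // v ≠ x} => d v.1) i
  have h3 := Fintype.sum_eq_add_sum_subtype_ne (mergeDegree d i x) i
  have h4 : ∑ v : {v // v ≠ i}, mergeDegree d i x v.1 = ∑ v : {v // v ≠ i}, d v.1.1 := by
    refine Finset.sum_congr rfl fun v _ => ?_
    have : v.1.1 ≠ i := fun h => v.2 (Subtype.ext h)
    simp [mergeDegree, this]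
  have h5 : mergeDegree d i x i = d i - 1 := by simp [mergeDegree, hx]
  have h6 : Fintype.card {v : V // v ≠ x} = Fintype.card V - 1 := by
    rw [Fintype.card_subtype_compl, Fintype.card_subtype_eq]
  simp only [hdeg, Finset.sum_add_distrib, Finset.sum_const, Finset.card_univ, smul_eq_mul,
    mul_one]
  omega

open Classical in
theorem sum_card_filter_adj {d : V → ℕ} (hx : d x = 0) :
    ∑ i, ((treesOfDegree d).filter fun T => T.Adj x i).card = (treesOfDegree d).card := by
  simp only [Finset.card_filter]
  rw [Finset.sum_comm, Finset.card_eq_sum_ones]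
  refine Finset.sum_congr rfl fun T hT => ?_
  rw [← Finset.card_filter, ← neighborFinset_eq_filter, card_neighborFinset_eq_degree,
    (mem_treesOfDegree.1 hT).2, hx]

open Classical in
theorem treeCount_mergeDegree_leaf {d : V → ℕ} (hx : d x = 0) {i : V} (hix : i ≠ x)
    (hi : 1 ≤ d i) (hV : 3 ≤ Fintype.card V) :
    treeCount (mergeDegree d i x) = treeCount d * (d i / ((Fintype.card V : ℝ) - 2)) := by
  obtain ⟨R, hR, e1, e2⟩ := treeCount_mergeDegree d hix hV
  rw [e1, e2, hx]
  obtain ⟨m, hm⟩ := Nat.exists_eq_add_of_le' hi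
  obtain ⟨s, hs⟩ := Nat.exists_eq_add_of_le' hV
  have : (s : ℝ) + 3 - 2 ≠ 0 := by have := s.cast_nonneg (α := ℝ); linarith
  rw [hm, hs, show m + 1 + 0 - 1 = m by omega, show s + 3 - 2 = s + 1 by omega,
    show s + 3 - 3 = s by omega, Nat.factorial_succ, Nat.factorial_succ]
  push_cast
  simp only [Nat.factorial_zero, Nat.cast_one, one_mul]
  field_simp
  ring

-- Attaching a leaf `x` to `i` is injective, and different `i` give disjoint families. The weights
-- `d i / (card V - 2)` now sum to exactly 1, so the induction loses nothing.
open Classical in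
theorem treeCount_le_card (n : ℕ) : ∀ (V : Type) [Fintype V] (d : V → ℕ), Fintype.card V = n →
    ∑ v, d v + 2 = Fintype.card V → treeCount d ≤ (treesOfDegree d).card := by
  induction n with
  | zero =>
    intro V _ d hV hsum
    omega
  | succ n ih =>
    intro V _ d hV hsum
    by_cases h3 : 3 ≤ Fintype.card V
    · obtain ⟨x, hx⟩ := exists_eq_zero_of_mem_treesOfDegree hsum
      have hs : (0 : ℝ) < (Fintype.card V : ℝ) - 2 := by
        have : (3 : ℝ) ≤ Fintype.card V := by exact_mod_cast h3
        linarith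
      have hcard : Fintype.card {v : V // v ≠ x} = Fintype.card V - 1 := by
        rw [Fintype.card_subtype_compl, Fintype.card_subtype_eq]
      have hterm : ∀ i, treeCount d * (d i / ((Fintype.card V : ℝ) - 2)) ≤
          (((treesOfDegree d).filter fun T => T.Adj x i).card : ℝ) := by
        intro i
        rcases Nat.eq_zero_or_pos (d i) with hi | hi
        · simp [hi]
        have hix : i ≠ x := by rintro rfl; omega
        rw [← treeCount_mergeDegree_leaf hx hix hi h3]
        refine (ih _ (mergeDegree d i x) (by omega) ?_).trans ?_
        · have h1 : ∑ v, d v = d x + ∑ v : {v : V // v ≠ x}, d v.1 :=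
            Fintype.sum_eq_add_sum_subtype_ne _ _
          have h2 := Fintype.sum_eq_add_sum_subtype_ne (fun v : {v : V // v ≠ x} => d v.1) ⟨i, hix⟩
          have h3 := Fintype.sum_eq_add_sum_subtype_ne (mergeDegree d i x) ⟨i, hix⟩
          have h4 : ∑ v : {v : {v : V // v ≠ x} // v ≠ ⟨i, hix⟩}, mergeDegree d i x v.1 =
              ∑ v : {v : {v : V // v ≠ x} // v ≠ ⟨i, hix⟩}, d v.1.1 := by
            refine Finset.sum_congr rfl fun v _ => ?_
            have : v.1.1 ≠ i := fun h => v.2 (Subtype.ext h)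
            simp [mergeDegree, this]
          have h5 : mergeDegree d i x ⟨i, hix⟩ = d i - 1 := by simp [mergeDegree, hx]
          simp only at h2
          omega
        · rw [Nat.cast_le]
          refine Finset.card_le_card_of_injOn (fun T => T.addLeaf ⟨i, hix⟩) ?_
            (addLeaf_injective _).injOn
          intro T hT
          rw [Finset.mem_coe, Finset.mem_filter]
          exact ⟨addLeaf_mem_treesOfDegree hx hi hT, addLeaf_adj_left.2 rfl⟩
      have htot := Finset.sum_le_sum fun i (_ : i ∈ Finset.univ) => hterm i
      rw [← Nat.cast_sum, sum_card_filter_adj hx, ← Finset.mul_sum, ← Finset.sum_div] at htot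
      have e : ∑ i, (d i : ℝ) = (Fintype.card V : ℝ) - 2 := by
        rw [← hsum]
        push_cast
        ring
      rwa [e, div_self hs.ne', mul_one] at htot
    · have h2 : Fintype.card V = 2 := by omega
      have hd : ∀ v, d v = 0 := by
        have : ∑ v, d v = 0 := by omega
        simpa using this
      have hF : treeCount d = 1 := by simp [treeCount, h2, hd]
      rw [hF]
      have : Nonempty V := Fintype.card_pos_iff.1 (by omega)
      have htop : ∀ T : SimpleGraph V, T = ⊤ → T ∈ treesOfDegree d := by
        intro T hT
        have hdeg : ∀ v, T.degree v = 1 := by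
          intro v
          have h : T.neighborFinset v = Finset.univ.erase v := by
            ext u
            rw [mem_neighborFinset, hT]
            simp [eq_comm]
          rw [← card_neighborFinset_eq_degree, h, Finset.card_erase_of_mem (Finset.mem_univ _),
            Finset.card_univ, h2]
        rw [mem_treesOfDegree]
        refine ⟨isTree_of_connected_of_sum_degree (hT ▸ connected_top) ?_, fun v => ?_⟩
        · simp [hdeg, h2]
        · rw [hdeg, hd]
      exact_mod_cast Finset.card_pos.2 ⟨_, htop ⊤ rfl⟩

end AddLeaf

end SimpleGraph

/-! ### Gluing leaves: symmetries and edges on cycles -/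

namespace SimpleGraph

variable {α : Type*}

theorem Reachable.of_forall_adj {H H' : SimpleGraph α} (f : α → α)
    (h : ∀ u v, H.Adj u v → H'.Reachable (f u) (f v)) {u v : α} (huv : H.Reachable u v) :
    H'.Reachable (f u) (f v) := by
  obtain ⟨p⟩ := huv
  induction p with
  | nil => exact Reachable.refl _
  | cons hadj _ ih => exact (h _ _ hadj).trans ih

/-- If all the edges of a trail but `s(a, b)` are kept, its ends are still joined to `a`
and `b`. -/
theorem Walk.reachable_of_mem_edges {H H' : SimpleGraph α} {a b u v : α} (p : H.Walk u v)
    (hp : p.edges.Nodup) (hab : s(a, b) ∈ p.edges)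
    (h : ∀ x y, s(x, y) ∈ p.edges → s(x, y) ≠ s(a, b) → H'.Reachable x y) :
    (H'.Reachable u a ∧ H'.Reachable b v) ∨ (H'.Reachable u b ∧ H'.Reachable a v) := by
  induction p with
  | nil => simp at hab
  | @cons u w v hadj p ih =>
    rw [Walk.edges_cons, List.nodup_cons] at hp
    by_cases he : s(u, w) = s(a, b)
    · have hwv : H'.Reachable w v := by
        have hall : ∀ x y, s(x, y) ∈ p.edges → H'.Reachable x y := by
          intro x y hxy
          refine h x y (by rw [Walk.edges_cons]; exact List.mem_cons_of_mem _ hxy) ?_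
          intro hxy'
          rw [hxy', ← he] at hxy
          exact hp.1 hxy
        clear ih h hp hab he hadj
        induction p with
        | nil => exact Reachable.refl _
        | @cons x y v hxy p ih =>
          refine (hall x y (by simp)).trans (ih fun x' y' h' => hall x' y' ?_)
          rw [Walk.edges_cons]
          exact List.mem_cons_of_mem _ h'
      rcases Sym2.eq_iff.1 he with ⟨rfl, rfl⟩ | ⟨rfl, rfl⟩
      · exact Or.inl ⟨Reachable.refl _, hwv⟩
      · exact Or.inr ⟨Reachable.refl _, hwv⟩
    · have huw : H'.Reachable u w := h u w (by simp) he
      rw [Walk.edges_cons, List.mem_cons] at hab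
      have := ih hp.2 (hab.resolve_left (Ne.symm he)) fun x y hxy =>
        h x y (by rw [Walk.edges_cons]; exact List.mem_cons_of_mem _ hxy)
      rcases this with ⟨h1, h2⟩ | ⟨h1, h2⟩
      · exact Or.inl ⟨huw.trans h1, h2⟩
      · exact Or.inr ⟨huw.trans h1, h2⟩

end SimpleGraph

namespace Multigraph

variable {α : Type*}

open Classical in
theorem erase_eq_filter {E : Multiset (Sym2 α)} {L : α} {e : Sym2 α}
    (h : E.filter (fun e => L ∈ e) = {e}) : E.erase e = E.filter (fun e => L ∉ e) := by
  conv_lhs => rw [← Multiset.filter_add_not (fun e => L ∈ e) E, h]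
  simp

open Classical in
theorem edges_glue_filter {G : Multigraph α} {L₁ L₂ F₁ F₂ : α} (hL : L₁ ≠ L₂)
    (h₁ : G.edges.filter (fun e => L₁ ∈ e) = {s(F₁, L₁)})
    (h₂ : G.edges.filter (fun e => L₂ ∈ e) = {s(F₂, L₂)})
    (h11 : F₁ ≠ L₁) (h12 : F₁ ≠ L₂) (h21 : F₂ ≠ L₁) (h22 : F₂ ≠ L₂) :
    (G.glue L₁ L₂).edges = s(F₁, F₂) ::ₘ G.edges.filter (fun e => L₁ ∉ e ∧ L₂ ∉ e) := by
  rw [edges_glue h₁ h₂ h11 h12 h21 h22, erase_eq_filter h₁]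
  have h : (G.edges.filter (fun e => L₁ ∉ e)).filter (fun e => L₂ ∈ e) = {s(F₂, L₂)} := by
    rw [Multiset.filter_comm, h₂, Multiset.filter_eq_self]
    simp [h21.symm, hL]
  rw [erase_eq_filter h, Multiset.filter_filter]
  congr 1
  exact Multiset.filter_congr fun e _ => and_comm

theorem filter_le_and_mem_filter {β : Type*} (p : β → Prop) {_ : DecidablePred p}
    (M : Multiset β) : M.filter p ≤ M ∧ ∀ a, a ∈ M.filter p ↔ a ∈ M ∧ p a :=
  ⟨Multiset.filter_le _ _, fun _ => Multiset.mem_filter⟩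

theorem filter_cons_filter {β : Type*} {p q r : β → Prop} {_ : DecidablePred p}
    {_ : DecidablePred q} {_ : DecidablePred r} (a : β) (M : Multiset β) (ha : p a)
    (h : ∀ e, r e ↔ p e ∧ q e) : (a ::ₘ M.filter q).filter p = a ::ₘ M.filter r := by
  rw [Multiset.filter_cons_of_pos _ ha, Multiset.filter_filter]
  congr 1
  exact Multiset.filter_congr fun e _ => (h e).symm

open Classical in
/-- The edges and the vertices after all gluings, for leaves `L 1, …, L (2k)` with fathers
`fa (L 1), …, fa (L (2k))`. -/
theorem glueAll_eq (L : ℕ → α) (fa : α → α) (k : ℕ) : ∀ G : Multigraph α,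
    (∀ a ∈ Finset.Icc 1 (2 * k), G.edges.filter (fun e => L a ∈ e) = {s(fa (L a), L a)}) →
    (∀ a ∈ Finset.Icc 1 (2 * k), ∀ b ∈ Finset.Icc 1 (2 * k), fa (L a) ≠ L b) →
    Set.InjOn L (Finset.Icc 1 (2 * k)) →
    (glueAll L k G).edges =
        (Multiset.range k).map (fun j => s(fa (L (2 * j + 1)), fa (L (2 * j + 2)))) +
          G.edges.filter (fun e => ∀ a ∈ Finset.Icc 1 (2 * k), L a ∉ e) ∧
      ∀ v, v ∈ (glueAll L k G).verts ↔ v ∈ G.verts ∧ ∀ a ∈ Finset.Icc 1 (2 * k), v ≠ L a := by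
  induction k with
  | zero =>
    intro G _ _ _
    simp [glueAll]
  | succ k ih =>
    intro G h hfa hinj
    have m1 : 2 * k + 1 ∈ Finset.Icc 1 (2 * (k + 1)) := by rw [Finset.mem_Icc]; omega
    have m2 : 2 * k + 2 ∈ Finset.Icc 1 (2 * (k + 1)) := by rw [Finset.mem_Icc]; omega
    have hsub : ∀ a ∈ Finset.Icc 1 (2 * k), a ∈ Finset.Icc 1 (2 * (k + 1)) ∧ a ≠ 2 * k + 1 ∧
        a ≠ 2 * k + 2 := by
      intro a ha
      rw [Finset.mem_Icc] at *
      omega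
    have hiff : ∀ P : ℕ → Prop, (∀ a ∈ Finset.Icc 1 (2 * (k + 1)), P a) ↔
        (∀ a ∈ Finset.Icc 1 (2 * k), P a) ∧ P (2 * k + 1) ∧ P (2 * k + 2) := by
      intro P
      constructor
      · exact fun h => ⟨fun a ha => h a (hsub a ha).1, h _ m1, h _ m2⟩
      · rintro ⟨h1, h2, h3⟩ a ha
        rw [Finset.mem_Icc] at ha
        by_cases e1 : a = 2 * k + 1
        · exact e1 ▸ h2
        by_cases e2 : a = 2 * k + 2
        · exact e2 ▸ h3
        exact h1 a (by rw [Finset.mem_Icc]; omega)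
    have hne : L (2 * k + 1) ≠ L (2 * k + 2) := fun e => by
      have := hinj m1 m2 e
      omega
    have he := edges_glue_filter hne (h _ m1) (h _ m2) (hfa _ m1 _ m1) (hfa _ m1 _ m2)
      (hfa _ m2 _ m1) (hfa _ m2 _ m2)
    -- No father is one of the leaves to be glued, so gluing one pair leaves the unique edge at
    -- every other leaf intact.
    obtain ⟨i1, i2⟩ := ih (G.glue (L (2 * k + 1)) (L (2 * k + 2))) (by
      intro a ha
      obtain ⟨ha', n1, n2⟩ := hsub a ha
      rw [he, Multiset.filter_cons_of_neg, Multiset.filter_comm, h a ha',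
        Multiset.filter_eq_self]
      · simp only [Multiset.mem_singleton, forall_eq, Sym2.mem_iff, not_or]
        exact ⟨⟨(hfa _ ha' _ m1).symm, fun e => n1 (hinj ha' m1 e.symm)⟩,
          (hfa _ ha' _ m2).symm, fun e => n2 (hinj ha' m2 e.symm)⟩
      · simp only [Sym2.mem_iff, not_or]
        exact ⟨(hfa _ m1 _ ha').symm, (hfa _ m2 _ ha').symm⟩)
      (fun a ha b hb => hfa a (hsub a ha).1 b (hsub b hb).1)
      (hinj.mono fun a ha => (hsub a ha).1)
    rw [glueAll]
    refine ⟨?_, ?_⟩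
    · rw [i1, he, filter_cons_filter _ _ _ fun e => hiff _, Multiset.range_succ,
        Multiset.map_cons, Multiset.add_cons, Multiset.cons_add]
      · intro a ha
        obtain ⟨ha', -⟩ := hsub a ha
        simp only [Sym2.mem_iff, not_or]
        exact ⟨(hfa _ m1 _ ha').symm, (hfa _ m2 _ ha').symm⟩
    · intro v
      rw [i2]
      simp only [glue, Finset.mem_erase, hiff]
      tauto

theorem sum_count_le_card {β : Type*} {_ : DecidableEq β} (M : Multiset β) (S : Finset β) :
    ∑ e ∈ S, M.count e ≤ M.card := by
  rw [← Multiset.sum_count_eq_card (s := S ∪ M.toFinset) (m := M)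
    fun a ha => Finset.mem_union_right _ (Multiset.mem_toFinset.2 ha)]
  exact Finset.sum_le_sum_of_subset Finset.subset_union_left

theorem factorial_succ_le_pow {k : ℕ} (c : ℕ) (h : c ≤ k) : (c + 1).factorial ≤ (k + 1) ^ c := by
  induction c with
  | zero => simp
  | succ c ih =>
    rw [Nat.factorial_succ, pow_succ, mul_comm]
    exact Nat.mul_le_mul (ih (by omega)) (by omega)

open Classical in
/-- Adding `k` edges to a simple graph gives at most `2 ^ k * (k + 1) ^ k` symmetries. -/
theorem circ_le {G : Multigraph α} {N : Multiset (Sym2 α)} {E : Finset (Sym2 α)}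
    (h : G.edges = N + E.val) (hE : ∀ v, s(v, v) ∉ E) :
    G.circ ≤ 2 ^ N.card * (N.card + 1) ^ N.card := by
  have hmult : ∀ e, G.mult e = N.count e + E.val.count e := by
    intro e
    rw [mult, h, Multiset.count_add]
  refine Nat.mul_le_mul ?_ ?_
  · rw [Finset.prod_pow_eq_pow_sum]
    refine Nat.pow_le_pow_right (by norm_num) ?_
    have e1 : ∑ v ∈ G.verts, G.mult s(v, v) = ∑ e ∈ G.verts.image Sym2.diag, N.count e := by
      rw [Finset.sum_image (Sym2.diag_injective.injOn)]
      refine Finset.sum_congr rfl fun v _ => ?_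
      rw [hmult, Multiset.count_eq_zero_of_notMem (hE v), add_zero]
      rfl
    rw [e1]
    exact sum_count_le_card _ _
  · calc ∏ e ∈ G.verts.sym2, (G.mult e).factorial
        ≤ ∏ e ∈ G.verts.sym2, (N.card + 1) ^ N.count e := by
          refine Finset.prod_le_prod' fun e _ => ?_
          -- The simple part contributes at most one copy of `e`, so an edge outside `N` costs a
          -- factor 1 only.
          refine (Nat.factorial_le ?_).trans (factorial_succ_le_pow (N.count e) (Multiset.count_le_card e N))
          rw [hmult]
          have := Multiset.nodup_iff_count_le_one.1 E.nodup e
          omega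
      _ = (N.card + 1) ^ ∑ e ∈ G.verts.sym2, N.count e := Finset.prod_pow_eq_pow_sum _ _ _
      _ ≤ _ := Nat.pow_le_pow_right (by omega) (sum_count_le_card _ _)

open Classical in
/-- An extra edge `s(x, y)` puts the edges of a path from `x` to `y` on a cycle. -/
theorem dist_lt_square {G : Multigraph α} {N E : Multiset (Sym2 α)} (h : G.edges = N + E)
    {x y : α} (hxy : s(x, y) ∈ N)
    (hconn : ∀ u ∈ G.verts, ∀ v ∈ G.verts,
      (SimpleGraph.fromEdgeSet {e : Sym2 α | e ∈ E}).Reachable u v) :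
    (SimpleGraph.fromEdgeSet {e : Sym2 α | e ∈ E}).dist x y < G.square := by
  set H := SimpleGraph.fromEdgeSet {e : Sym2 α | e ∈ E} with hH
  have hmem : s(x, y) ∈ G.edges := by rw [h]; exact Multiset.mem_add.2 (Or.inl hxy)
  have hx : x ∈ G.verts := G.incidence _ hmem x (by simp)
  have hy : y ∈ G.verts := G.incidence _ hmem y (by simp)
  obtain ⟨p, hp, hlen⟩ := (hconn x hx y hy).exists_path_of_dist
  have hpE : ∀ e ∈ p.edges, e ∈ E := by
    intro e he
    have := p.edges_subset_edgeSet he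
    rw [hH, SimpleGraph.edgeSet_fromEdgeSet] at this
    exact this.1
  -- The extra edge and the geodesic `p` form a closed walk, none of whose edges is a bridge.
  have hle : s(x, y) ::ₘ (p.edges : Multiset (Sym2 α)) ≤ G.cyc := by
    rw [cyc, Multiset.le_filter]
    constructor
    · rw [h, ← Multiset.singleton_add]
      refine add_le_add (Multiset.singleton_le.2 hxy) ?_
      rw [Multiset.le_iff_subset (Multiset.coe_nodup.2 hp.isTrail.edges_nodup)]
      intro e he
      exact hpE e (by simpa using he)
    · intro e he
      rw [Multiset.mem_cons, Multiset.mem_coe] at he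
      refine ⟨⟨x, hx⟩, fun u hu v hv => ?_⟩
      change (SimpleGraph.fromEdgeSet {f : Sym2 α | f ∈ G.edges.erase e}).Reachable u v
      set H' := SimpleGraph.fromEdgeSet {f : Sym2 α | f ∈ G.edges.erase e} with hH'
      rcases he with rfl | he
      · refine (hconn u hu v hv).mono (SimpleGraph.fromEdgeSet_mono fun f hf => ?_)
        rw [Set.mem_ofPred_eq, h, Multiset.erase_add_left_pos _ hxy]
        exact Multiset.mem_add.2 (Or.inr hf)
      · have herase : G.edges.erase e = N + E.erase e := by
          rw [h, Multiset.erase_add_right_pos _ (hpE e he)]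
        have hadj : ∀ a b, s(a, b) ∈ E → s(a, b) ≠ e → H'.Reachable a b := by
          intro a b hab hne
          by_cases hab' : a = b
          · exact hab' ▸ SimpleGraph.Reachable.refl _
          refine SimpleGraph.Adj.reachable ?_
          rw [hH', SimpleGraph.fromEdgeSet_adj, Set.mem_ofPred_eq, herase]
          exact ⟨Multiset.mem_add.2 (Or.inr ((Multiset.mem_erase_of_ne hne).2 hab)), hab'⟩
        have hxy' : H'.Reachable x y := by
          by_cases hxy' : x = y
          · exact hxy' ▸ SimpleGraph.Reachable.refl _
          refine SimpleGraph.Adj.reachable ?_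
          rw [hH', SimpleGraph.fromEdgeSet_adj, Set.mem_ofPred_eq, herase]
          exact ⟨Multiset.mem_add.2 (Or.inl hxy), hxy'⟩
        induction e with
        | _ a b =>
          -- The ends of a deleted path edge are joined by the rest of `p` and the extra edge `s(x,
          -- y)`.
          have hab : H'.Reachable a b := by
            rcases p.reachable_of_mem_edges (H' := H') hp.isTrail.edges_nodup he
              (fun s t hst hne => hadj s t (hpE _ hst) hne) with ⟨h1, h2⟩ | ⟨h1, h2⟩
            · exact h1.symm.trans (hxy'.trans h2.symm)
            · exact h2.trans (hxy'.symm.trans h1)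
          refine SimpleGraph.Reachable.of_forall_adj id (fun s t hst => ?_) (hconn u hu v hv)
          rw [hH, SimpleGraph.fromEdgeSet_adj] at hst
          by_cases hne : s(s, t) = s(a, b)
          · rcases Sym2.eq_iff.1 hne with ⟨rfl, rfl⟩ | ⟨rfl, rfl⟩
            · exact hab
            · exact hab.symm
          · exact hadj s t hst.1 hne
  have := Multiset.card_le_card hle
  rw [Multiset.card_cons, Multiset.coe_card, SimpleGraph.Walk.length_edges, hlen] at this
  exact this

end Multigraph

namespace SimpleGraph

variable {α : Type*}

open Classical in
/-- The only neighbour of a leaf. -/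
noncomputable def leafNeighbor (T : SimpleGraph α) (v : α) : α :=
  if h : ∃ w, T.Adj v w then h.choose else v

open Classical in
theorem adj_iff_eq_leafNeighbor [Fintype α] {T : SimpleGraph α} {v w : α} (h : T.degree v = 1) :
    T.Adj v w ↔ w = T.leafNeighbor v := by
  obtain ⟨u, hu, huniq⟩ := degree_eq_one_iff_existsUnique_adj.1 h
  have hex : ∃ w, T.Adj v w := ⟨u, hu⟩
  have hc : T.leafNeighbor v = u := by
    rw [leafNeighbor, dif_pos hex]
    exact huniq _ hex.choose_spec
  rw [hc]
  exact ⟨fun h => huniq w h, fun h => h ▸ hu⟩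

-- If two leaves were adjacent, each would be strictly nearer to a third vertex than the other.
open Classical in
theorem Connected.not_adj_of_degree_eq_one [Fintype α] {T : SimpleGraph α} (hT : T.Connected)
    (hcard : 3 ≤ Fintype.card α) {u v : α} (hu : T.degree u = 1) (hv : T.degree v = 1) :
    ¬ T.Adj u v := by
  intro huv
  obtain ⟨w, hw⟩ : ∃ w, w ∉ ({u, v} : Finset α) := by
    by_contra! h
    have := Finset.card_le_card (fun x _ => h x : (Finset.univ : Finset α) ⊆ {u, v})
    have h2 := Finset.card_le_two (a := u) (b := v)
    rw [Finset.card_univ] at this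
    omega
  simp only [Finset.mem_insert, Finset.mem_singleton, not_or] at hw
  obtain ⟨i, hi, hiw⟩ := hT.exists_adj_dist_add_one (Ne.symm hw.1)
  obtain ⟨j, hj, hjw⟩ := hT.exists_adj_dist_add_one (Ne.symm hw.2)
  rw [(adj_iff_eq_leafNeighbor hu).1 hi, ← (adj_iff_eq_leafNeighbor hu).1 huv] at hiw
  rw [(adj_iff_eq_leafNeighbor hv).1 hj, ← (adj_iff_eq_leafNeighbor hv).1 huv.symm] at hjw
  omega

open Classical in
/-- Gluing `k` pairs of leaves of a tree: the symmetries of the result are bounded, and the number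
of edges on cycles is at least the distance of each glued pair, minus one. -/
theorem IsTree.circ_le_and_dist_le_square [Fintype α] {T : SimpleGraph α} (hT : T.IsTree)
    (hcard : 3 ≤ Fintype.card α) (L : ℕ → α) (k : ℕ)
    (hdeg : ∀ a ∈ Finset.Icc 1 (2 * k), T.degree (L a) = 1)
    (hinj : Set.InjOn L (Finset.Icc 1 (2 * k))) :
    (T.toMultigraph.glueAll L k).circ ≤ 2 ^ k * (k + 1) ^ k ∧
      ∀ j < k, T.dist (L (2 * j + 1)) (L (2 * j + 2)) ≤
        (T.toMultigraph.glueAll L k).square + 1 := by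
  set fa := T.leafNeighbor with hfa
  have hne : ∀ a ∈ Finset.Icc 1 (2 * k), ∀ b ∈ Finset.Icc 1 (2 * k), fa (L a) ≠ L b := by
    intro a ha b hb h
    exact hT.1.not_adj_of_degree_eq_one hcard (hdeg a ha) (hdeg b hb)
      ((adj_iff_eq_leafNeighbor (hdeg a ha)).2 h.symm)
  have hedges : ∀ e, e ∈ T.toMultigraph.edges ↔ e ∈ T.edgeSet := by
    intro e
    change e ∈ T.edgeFinset.val ↔ _
    rw [Finset.mem_val, mem_edgeFinset]
  have hnodup : T.toMultigraph.edges.Nodup := T.edgeFinset.nodup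
  have hfilter : ∀ a ∈ Finset.Icc 1 (2 * k),
      T.toMultigraph.edges.filter (fun e => L a ∈ e) = {s(fa (L a), L a)} := by
    intro a ha
    rw [(hnodup.filter _).ext (Multiset.nodup_singleton _)]
    intro e
    rw [Multiset.mem_filter, Multiset.mem_singleton, hedges]
    constructor
    · rintro ⟨he, hLe⟩
      obtain ⟨w, rfl⟩ := Sym2.mem_iff_exists.1 hLe
      rw [mem_edgeSet, adj_iff_eq_leafNeighbor (hdeg a ha)] at he
      rw [he, Sym2.eq_swap]
    · rintro rfl
      refine ⟨?_, by simp⟩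
      rw [mem_edgeSet, adj_comm, adj_iff_eq_leafNeighbor (hdeg a ha)]
  obtain ⟨hE, hV⟩ := Multigraph.glueAll_eq L fa k T.toMultigraph hfilter hne hinj
  set G := T.toMultigraph.glueAll L k with hG
  set N := (Multiset.range k).map (fun j => s(fa (L (2 * j + 1)), fa (L (2 * j + 2)))) with hN
  set E := T.toMultigraph.edges.filter (fun e => ∀ a ∈ Finset.Icc 1 (2 * k), L a ∉ e)
  obtain ⟨hEle, hEmem'⟩ : E ≤ T.toMultigraph.edges ∧ ∀ e, e ∈ E ↔ e ∈ T.toMultigraph.edges ∧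
      ∀ a ∈ Finset.Icc 1 (2 * k), L a ∉ e := Multigraph.filter_le_and_mem_filter _ _
  have hNcard : N.card = k := by rw [hN, Multiset.card_map, Multiset.card_range]
  have hEmem : ∀ u v, s(u, v) ∈ E ↔ T.Adj u v ∧ ∀ a ∈ Finset.Icc 1 (2 * k), L a ≠ u ∧ L a ≠ v := by
    intro u v
    rw [hEmem', hedges, mem_edgeSet]
    simp only [Sym2.mem_iff, not_or, ne_eq]
  set H := fromEdgeSet {e : Sym2 α | e ∈ E} with hH
  have hHadj : ∀ u v, H.Adj u v ↔ T.Adj u v ∧ ∀ a ∈ Finset.Icc 1 (2 * k), L a ≠ u ∧ L a ≠ v := by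
    intro u v
    rw [hH, fromEdgeSet_adj, Set.mem_ofPred_eq, hEmem]
    exact ⟨fun h => h.1, fun h => ⟨h, h.1.ne⟩⟩
  constructor
  · have := Multigraph.circ_le (G := G) (N := N) (E := ⟨E, Multiset.nodup_of_le hEle hnodup⟩) hE (fun v hv => by
      have := ((hEmem v v).1 hv).1
      exact this.ne rfl)
    rwa [hNcard] at this
  · intro j hj
    have m1 : 2 * j + 1 ∈ Finset.Icc 1 (2 * k) := by rw [Finset.mem_Icc]; omega
    have m2 : 2 * j + 2 ∈ Finset.Icc 1 (2 * k) := by rw [Finset.mem_Icc]; omega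
    -- The retraction of the deleted leaves onto their neighbours carries walks of `T` to walks
    -- avoiding these leaves.
    set r : α → α := fun v => if ∃ a ∈ Finset.Icc 1 (2 * k), L a = v then fa v else v with hr
    have hr1 : ∀ v, (∀ a ∈ Finset.Icc 1 (2 * k), L a ≠ v) → r v = v := by
      intro v hv
      simp only [hr]
      rw [if_neg]
      rintro ⟨a, ha, h⟩
      exact hv a ha h
    have hradj : ∀ a ∈ Finset.Icc 1 (2 * k), ∀ v, T.Adj (L a) v → r (L a) = r v := by
      intro a ha v hv
      rw [adj_iff_eq_leafNeighbor (hdeg a ha)] at hv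
      rw [hr1 v (fun b hb h => hne a ha b hb (hv.symm.trans h.symm))]
      simp only [hr]
      rw [if_pos ⟨a, ha, rfl⟩, hv]
    have hconn : ∀ u ∈ G.verts, ∀ v ∈ G.verts, H.Reachable u v := by
      intro u hu v hv
      rw [hV] at hu hv
      have := Reachable.of_forall_adj (H' := H) r (fun x y hxy => ?_) (hT.1.preconnected u v)
      · rwa [hr1 u fun a ha => (hu.2 a ha).symm, hr1 v fun a ha => (hv.2 a ha).symm] at this
      · by_cases hx : ∃ a ∈ Finset.Icc 1 (2 * k), L a = x
        · obtain ⟨a, ha, rfl⟩ := hx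
          rw [hradj a ha y hxy]
        · by_cases hy : ∃ a ∈ Finset.Icc 1 (2 * k), L a = y
          · obtain ⟨a, ha, rfl⟩ := hy
            rw [hradj a ha x hxy.symm]
          · push Not at hx hy
            rw [hr1 x hx, hr1 y hy]
            exact ((hHadj x y).2 ⟨hxy, fun a ha => ⟨hx a ha, hy a ha⟩⟩).reachable
    have hmem : s(fa (L (2 * j + 1)), fa (L (2 * j + 2))) ∈ N := by
      rw [hN, Multiset.mem_map]
      exact ⟨j, Multiset.mem_range.2 hj, rfl⟩
    have hlt := Multigraph.dist_lt_square hE hmem hconn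
    change H.dist _ _ < _ at hlt
    have hmemG : s(fa (L (2 * j + 1)), fa (L (2 * j + 2))) ∈ G.edges := by
      rw [hE]
      exact Multiset.mem_add.2 (Or.inl hmem)
    have hreach := hconn _ (G.incidence _ hmemG (fa (L (2 * j + 1))) (by simp)) _
      (G.incidence _ hmemG (fa (L (2 * j + 2))) (by simp))
    have hle : H ≤ T := fun u v h => ((hHadj u v).1 h).1
    -- `H` is a subgraph of `T`, so its distances dominate. The two leaf edges add 2, and the strict
    -- inequality `hlt` takes back 1.
    have hd := hreach.dist_anti hle
    have t1 := hT.1.dist_triangle (u := L (2 * j + 1)) (v := fa (L (2 * j + 1)))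
      (w := L (2 * j + 2))
    have t2 := hT.1.dist_triangle (u := fa (L (2 * j + 1))) (v := fa (L (2 * j + 2)))
      (w := L (2 * j + 2))
    rw [dist_eq_one_iff_adj.2 ((adj_iff_eq_leafNeighbor (hdeg _ m1)).2 rfl)] at t1
    rw [dist_eq_one_iff_adj.2 ((adj_iff_eq_leafNeighbor (hdeg _ m2)).2 rfl).symm] at t2
    omega

end SimpleGraph

/-! ### From weights of leaf pairs to the bias of a random tree -/

namespace DegreeSeq

open SimpleGraph

/-- The number of children of a vertex of a tree with degree sequence `D`. -/
def children (D : DegreeSeq) : D.Vert → ℕ := Sum.elim (fun i => D.d i) fun _ => 0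

theorem sum_children (D : DegreeSeq) {M : Type*} [AddCommMonoid M] (f : ℕ → M) (hf : f 0 = 0) :
    ∑ v, f (D.children v) = ∑ i, f (D.d i) := by
  rw [Fintype.sum_sum_type]
  simp only [children, Sum.elim_inl, Sum.elim_inr, hf, Finset.sum_const_zero, add_zero]
  rw [← Finset.sum_subtype (Finset.univ.filter fun i => 0 < D.d i) (by simp)
    (fun i => f (D.d i)), Finset.sum_filter]
  refine Finset.sum_congr rfl fun i _ => ?_
  split_ifs with h
  · rfl
  · rw [Nat.eq_zero_of_not_pos h, hf]

theorem card_vert (D : DegreeSeq) : Fintype.card D.Vert = D.s := by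
  rw [Fintype.card_sum, Fintype.card_fin, ← D.card_zeros, Fintype.card_subtype]
  have := Finset.card_filter_add_card_filter_not (s := (Finset.univ : Finset (Fin D.s)))
    (fun i => 0 < D.d i)
  simp only [not_lt, Nat.le_zero, Finset.card_univ, Fintype.card_fin] at this
  exact this

theorem sum_children_add_two (D : DegreeSeq) :
    ∑ v, D.children v + 2 = Fintype.card D.Vert := by
  have h := D.sum_children id rfl
  simp only [id] at h
  rw [h, card_vert]
  exact D.sum_add_two

-- Only the degrees of the `Vᵢ` are prescribed in `trees`; the degree sum of a tree, with all
-- degrees positive, forces the remaining vertices to be leaves.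
open Classical in
theorem trees_eq (D : DegreeSeq) : D.trees = treesOfDegree D.children := by
  ext T
  rw [mem_treesOfDegree, trees, Finset.mem_filter]
  constructor
  · rintro ⟨-, hT, hdeg⟩
    refine ⟨hT, ?_⟩
    have : Nontrivial D.Vert :=
      ⟨Sum.inr 0, Sum.inr 1, fun h => by simp at h⟩
    have hpos : ∀ v, 1 ≤ T.degree v := fun v =>
      hT.1.preconnected.degree_pos_of_nontrivial v
    have hle : ∀ v ∈ Finset.univ, D.children v + 1 ≤ T.degree v := by
      rintro (i | j) -
      · exact (hdeg i).ge
      · exact hpos _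
    have hsum : ∑ v, (D.children v + 1) = ∑ v, T.degree v := by
      have h1 := hT.sum_degree
      have h2 := D.sum_children_add_two
      simp only [Finset.sum_add_distrib, Finset.sum_const, Finset.card_univ, smul_eq_mul, mul_one]
      omega
    intro v
    exact ((Finset.sum_eq_sum_iff_of_le hle).1 hsum v (Finset.mem_univ v)).symm
  · rintro ⟨hT, hdeg⟩
    exact ⟨Finset.mem_univ _, hT, fun i => hdeg (Sum.inl i)⟩

theorem sigma_sq (D : DegreeSeq) :
    D.sigma ^ 2 = ∑ v, (D.children v : ℝ) * ((D.children v : ℝ) - 1) := by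
  rw [D.sum_children (fun n => (n : ℝ) * ((n : ℝ) - 1)) (by simp), sigma, Real.sq_sqrt]
  exact Finset.sum_nonneg fun i _ => natCast_mul_sub_one_nonneg _

/-- Sum `d - 1 + 1_{d = 0} ≤ d (d - 1)` over all entries: the left side totals `(s - 2) - s + (N +
2) = N`. -/
theorem N_le_sigma_sq (D : DegreeSeq) : (D.N : ℝ) ≤ D.sigma ^ 2 := by
  have hs : (∑ i, (D.d i : ℝ)) + 2 = D.s := by exact_mod_cast D.sum_add_two
  have hz : ∑ i, (if D.d i = 0 then (1 : ℝ) else 0) = D.N + 2 := by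
    rw [Finset.sum_boole]
    exact_mod_cast D.card_zeros
  rw [D.sigma_sq, D.sum_children (fun n => (n : ℝ) * ((n : ℝ) - 1)) (by simp)]
  have h1 : ∑ i, ((D.d i : ℝ) - 1 + if D.d i = 0 then (1 : ℝ) else 0) ≤
      ∑ i, (D.d i : ℝ) * ((D.d i : ℝ) - 1) := by
    refine Finset.sum_le_sum fun i _ => ?_
    split_ifs with h
    · simp [h]
    · have : (1 : ℝ) ≤ D.d i := by exact_mod_cast Nat.one_le_iff_ne_zero.2 h
      nlinarith
  rw [Finset.sum_add_distrib, Finset.sum_sub_distrib, hz] at h1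
  simp only [Finset.sum_const, Finset.card_univ, Fintype.card_fin, nsmul_eq_mul, mul_one] at h1
  linarith

theorem star_injOn (D : DegreeSeq) : Set.InjOn D.star (Set.Iio (D.N + 2)) := by
  intro a ha b hb h
  simp only [star, Sum.inr.injEq, Fin.ofNat, Fin.mk.injEq] at h
  rwa [Nat.mod_eq_of_lt ha, Nat.mod_eq_of_lt hb] at h

theorem bias_nonneg (D : DegreeSeq) (k : ℕ) (T : SimpleGraph D.Vert) : 0 ≤ D.bias k T := by
  unfold bias
  exact div_nonneg (by positivity) (Finset.prod_nonneg fun _ _ => by positivity)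

/-- The bias in terms of the distances of the glued leaves. -/
theorem bias_rpow_le (D : DegreeSeq) {k : ℕ} (hk : 1 ≤ k) (hN : 2 * k ≤ D.N)
    {T : SimpleGraph D.Vert} (hT : T ∈ D.trees) :
    D.bias k T ^ (3 / 2 : ℝ) ≤
      (2 ^ k * (k + 1) ^ k * 2 ^ k : ℝ) ^ (3 / 2 : ℝ) *
        pairWeight T (fun a => D.star (a + 1)) k := by
  classical
  rw [trees_eq, mem_treesOfDegree] at hT
  have hcard : 3 ≤ Fintype.card D.Vert := by
    rw [Fintype.card_sum, Fintype.card_fin]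
    omega
  have key : ∀ i ≤ k, _ := fun i (hi : i ≤ k) =>
    hT.1.circ_le_and_dist_le_square hcard D.star i
      (fun a _ => by rw [hT.2]; rfl)
      (D.star_injOn.mono fun a ha => by
        rw [Finset.mem_coe, Finset.mem_Icc] at ha
        rw [Set.mem_Iio]
        omega)
  have hcirc : ((D.glued k T).circ : ℝ) ≤ 2 ^ k * (k + 1) ^ k := by
    exact_mod_cast (key k le_rfl).1
  have hprod : (∏ i ∈ Finset.Icc 1 k, ((D.glued i T).square : ℝ))⁻¹ ≤
      2 ^ k * ∏ j ∈ Finset.range k, (T.dist (D.star (2 * j + 1)) (D.star (2 * j + 2)) : ℝ)⁻¹ := by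
    have e1 : ∏ i ∈ Finset.Icc 1 k, ((D.glued i T).square : ℝ) =
        ∏ j ∈ Finset.range k, ((D.glued (j + 1) T).square : ℝ) := by
      rw [Finset.range_eq_Ico, Finset.prod_Ico_add' (fun i => ((D.glued i T).square : ℝ)) 0 k 1]
      rfl
    have e2 : (2 : ℝ) ^ k = ∏ j ∈ Finset.range k, (2 : ℝ) := by simp
    rw [e1, e2, ← Finset.prod_inv_distrib, ← Finset.prod_mul_distrib]
    refine Finset.prod_le_prod (fun _ _ => by positivity) fun j hj => ?_
    rw [Finset.mem_range] at hj
    -- Each intermediate graph is used only through its most recently listed pair, so every pair is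
    -- counted once.
    have hle := (key (j + 1) (by omega)).2 j (by omega)
    have hpos : 0 < T.dist (D.star (2 * j + 1)) (D.star (2 * j + 2)) := by
      refine hT.1.1.pos_dist_of_ne fun h => ?_
      have := D.star_injOn (Set.mem_Iio.2 (by omega)) (Set.mem_Iio.2 (by omega)) h
      omega
    -- Distance at least 2 turns `dist ≤ square + 1` into `dist ≤ 2 * square`.
    have hne : T.dist (D.star (2 * j + 1)) (D.star (2 * j + 2)) ≠ 1 := by
      intro h
      exact hT.1.1.not_adj_of_degree_eq_one hcard (by rw [hT.2]; rfl) (by rw [hT.2]; rfl)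
        (dist_eq_one_iff_adj.1 h)
    have hle' : (T.dist (D.star (2 * j + 1)) (D.star (2 * j + 2)) : ℝ) ≤
        2 * ((D.glued (j + 1) T).square : ℝ) := by
      have : T.dist (D.star (2 * j + 1)) (D.star (2 * j + 2)) ≤
        2 * (D.glued (j + 1) T).square := by
        change _ ≤ 2 * (T.toMultigraph.glueAll D.star (j + 1)).square
        omega
      exact_mod_cast this
    have hpos' : (0 : ℝ) < T.dist (D.star (2 * j + 1)) (D.star (2 * j + 2)) := by
      exact_mod_cast hpos
    have hsq : (0 : ℝ) < (D.glued (j + 1) T).square := by linarith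
    rw [← div_eq_mul_inv, inv_eq_one_div, div_le_div_iff₀ hsq hpos']
    linarith
  have hP0 : 0 ≤ ∏ j ∈ Finset.range k,
      (T.dist (D.star (2 * j + 1)) (D.star (2 * j + 2)) : ℝ)⁻¹ :=
    Finset.prod_nonneg fun _ _ => by positivity
  have hbias : D.bias k T ≤ (2 ^ k * (k + 1) ^ k * 2 ^ k : ℝ) *
      ∏ j ∈ Finset.range k, (T.dist (D.star (2 * j + 1)) (D.star (2 * j + 2)) : ℝ)⁻¹ := by
    rw [bias, div_eq_mul_inv, mul_assoc _ ((2 : ℝ) ^ k)]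
    exact mul_le_mul hcirc hprod
      (inv_nonneg.2 (Finset.prod_nonneg fun _ _ => by positivity)) (by positivity)
  refine (Real.rpow_le_rpow (D.bias_nonneg k T) hbias (by norm_num)).trans (le_of_eq ?_)
  rw [Real.mul_rpow (by positivity) hP0, ← Real.finsetProd_rpow _ _ fun _ _ => by positivity]
  congr 1
  refine Finset.prod_congr rfl fun j _ => ?_
  rw [distWeight, Real.inv_rpow (by positivity), ← Real.rpow_neg (by positivity)]

end DegreeSeq

/-- On `x ≥ m` the extra factor `√(x / m)` is at least 1, so a bounded 3/2-moment yields decay `1 /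
√m`. -/
theorem truncBelow_le {m x : ℝ} (hm : 0 < m) (hx : 0 ≤ x) :
    truncBelow m x ≤ x ^ (3 / 2 : ℝ) / √m := by
  unfold truncBelow
  split_ifs with h
  · have hx0 : 0 < x := hm.trans_le h
    rw [le_div_iff₀ (Real.sqrt_pos.2 hm)]
    calc x * √m ≤ x * √x := by gcongr
      _ = x ^ (1 : ℝ) * x ^ (1 / 2 : ℝ) := by rw [Real.rpow_one, Real.sqrt_eq_rpow]
      _ = x ^ (3 / 2 : ℝ) := by rw [← Real.rpow_add hx0]; norm_num
  · positivity

namespace DegreeSeq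

open SimpleGraph

theorem expectation_truncBelow_le {k : ℕ} (hk : 1 ≤ k) {C : ℝ} (hC : 0 ≤ C)
    (hb : PairBound k C) (D : DegreeSeq) (hN : 2 * k ≤ D.N) {m : ℝ} (hm : 0 < m) :
    (D.expectation fun T => truncBelow m (D.bias k T / D.lam ^ k)) ≤
      (2 ^ k * (k + 1) ^ k * 2 ^ k : ℝ) ^ (3 / 2 : ℝ) * C / √m := by
  set A := (2 ^ k * (k + 1) ^ k * 2 ^ k : ℝ) ^ (3 / 2 : ℝ) with hA
  have hA0 : 0 ≤ A := by positivity
  have hsig0 : 0 ≤ D.sigma := Real.sqrt_nonneg _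
  -- `PairBound` requires `q ≥ 1`; this holds for `q = σ` because `σ² ≥ N ≥ 2`.
  have hsig : 1 ≤ D.sigma := by
    have h1 := D.N_le_sigma_sq
    have h2 : (2 : ℝ) ≤ D.N := by exact_mod_cast (by omega : 2 ≤ D.N)
    nlinarith
  have hs : (0 : ℝ) < D.s := by exact_mod_cast (by have := D.sum_add_two; omega : 0 < D.s)
  have hlam : 0 < D.lam := div_pos (by linarith) hs
  have hm' : 0 < √m := Real.sqrt_pos.2 hm
  have hcard : 0 < (D.trees.card : ℝ) := by
    rw [trees_eq]
    exact (treeCount_pos _).trans_le (treeCount_le_card _ _ _ rfl D.sum_children_add_two)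
  rw [expectation, div_le_iff₀ hcard]
  have hlamk : (D.lam ^ k) ^ (3 / 2 : ℝ) = D.lam ^ (3 / 2 * k : ℝ) := by
    rw [← Real.rpow_natCast, ← Real.rpow_mul hlam.le, mul_comm]
  have hL : PairLeaves D.children (fun a => D.star (a + 1)) k := by
    constructor
    · intro a _
      rfl
    · intro a ha b hb h
      rw [Set.mem_Iio] at ha hb
      have := D.star_injOn (Set.mem_Iio.2 (by omega)) (Set.mem_Iio.2 (by omega)) h
      omega
  have hsum := hb D.Vert D.children _ D.sigma hsig D.sigma_sq.ge hL
  rw [← trees_eq, card_vert] at hsum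
  have hlp : 0 < D.lam ^ (3 / 2 * k : ℝ) := by positivity
  calc ∑ T ∈ D.trees, truncBelow m (D.bias k T / D.lam ^ k)
      ≤ ∑ T ∈ D.trees, A / (D.lam ^ (3 / 2 * k : ℝ) * √m) *
          pairWeight T (fun a => D.star (a + 1)) k := by
        refine Finset.sum_le_sum fun T hT => ?_
        refine (truncBelow_le hm (div_nonneg (D.bias_nonneg k T) (by positivity))).trans ?_
        rw [Real.div_rpow (D.bias_nonneg k T) (by positivity), hlamk, div_div, div_mul_eq_mul_div A]
        exact div_le_div_of_nonneg_right (D.bias_rpow_le hk hN hT) (by positivity)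
    _ = A / (D.lam ^ (3 / 2 * k : ℝ) * √m) *
          ∑ T ∈ D.trees, pairWeight T (fun a => D.star (a + 1)) k := by rw [Finset.mul_sum]
    _ ≤ A / (D.lam ^ (3 / 2 * k : ℝ) * √m) *
          (treeCount D.children * (C * D.lam ^ (3 / 2 * k : ℝ))) := by
        gcongr
        exact hsum
    _ = A * C / √m * treeCount D.children := by field_simp
    _ ≤ A * C / √m * D.trees.card := by
        rw [trees_eq]
        gcongr
        exact treeCount_le_card _ _ _ rfl D.sum_children_add_two

end DegreeSeq

theorem proposition1 (k : ℕ) (hk : 1 ≤ k) :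
    Tendsto
      (fun m : ℝ => ⨆ (D : DegreeSeq) (_ : 2 * k ≤ D.N),
        ENNReal.ofReal
          (D.expectation fun T => truncBelow m (D.bias k T / D.lam ^ k)))
      atTop (𝓝 0) := by
  obtain ⟨C, hC, hb⟩ := SimpleGraph.exists_pairBound k
  set A : ℝ := (2 ^ k * (k + 1) ^ k * 2 ^ k : ℝ) ^ (3 / 2 : ℝ) * C with hA
  have hlim : Tendsto (fun m : ℝ => ENNReal.ofReal (A / √m)) atTop (𝓝 0) := by
    rw [← ENNReal.ofReal_zero]
    exact ENNReal.tendsto_ofReal (Real.tendsto_sqrt_atTop.const_div_atTop A)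
  refine tendsto_of_tendsto_of_tendsto_of_le_of_le' tendsto_const_nhds hlim
    (Eventually.of_forall fun _ => zero_le) ?_
  filter_upwards [eventually_gt_atTop 0] with m hm
  exact iSup₂_le fun D hD => ENNReal.ofReal_le_ofReal (D.expectation_truncBelow_le hk hC hb hD hm)
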